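/- **Setting.** Let $\mathbb H$ be the quaternions and let $\Omega^1$ be the first order differential calculus on $\mathbb H$ that is free as a left module on $di, dj$ and satisfies $dk=-j\,di+i\,dj$ (the maximal $\{i,j\}$-terminal calculus). Thus $di\,h=(khk^{-1})\,di$, $dj\,h=(khk^{-1})\,dj$, and $dh=\partial_i(h)\,di+\partial_j(h)\,dj$ with $\partial_i h=h_i-h_kj$, $\partial_j h=h_j+h_ki$ for $h=h_1+h_ii+h_jj+h_kk$. Equip it with the maximal exterior algebra, so that $\Omega^2$ is the quotient of $\Omega^1\otimes_{\mathbb H}\Omega^1$ by the left submodule generated by all $\sum_r da_r\otimes db_r$ with $\sum_r a_r\,db_r=0$, and put $S^2=\ker(\wedge:\Omega^1\otimes_{\mathbb H}\Omega^1\to\Omega^2)$. *Jets, operators, symbols.* $J^0\mathbb H=\mathbb H$; $J^1E$ is the extension of $E$ by $\Omega^1\otimes_{\mathbb H}E$ with prolongation $j^1$ and $j^1(ae)=a\,j^1(e)+\iota^1(da\otimes e)$; $J^2E\subseteq J^1J^1E$ consists of the elements whose two projections to $J^1E$ agree and which the Spencer operators send to $0$ in $\Omega^2\otimes_{\mathbb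 H}E$; and $J^{n+2}\mathbb H=J^1(J^{n+1}\mathbb H)\cap J^2(J^n\mathbb H)$. $\mathrm{Diff}^n$ is the space of maps $\Delta=\tilde\Delta\circ j^n:\mathbb H\to\mathbb H$ with $\tilde\Delta:J^n\mathbb H\to\mathbb H$ left $\mathbb H$-linear, $\mathrm{Symb}^n=\mathrm{Diff}^n/\mathrm{Diff}^{n-1}$ with quotient map $\varsigma^n$, and $\mathrm{Symb}^\bullet=\bigoplus_n\mathrm{Symb}^n$ with the product $\cdot$ induced by composition and unit $1=\varsigma^0(\mathrm{id})$. *Quantization.* A full quantization is a family of linear sections $q^n:\mathrm{Symb}^n\to\mathrm{Diff}^n$ of $\varsigma^n$ compatible with composition on the left with left $\mathbb H$-linear maps $\mathbb H\to\mathbb H$. Let $\nabla$ be the flat Levi-Civita bimodule connection $\nabla(a\,di+b\,dj)=da\otimes di+db\otimes dj$ of the metric $g=di\otimes dj-dj\otimes di$. Its generalized braiding is the $\mathbb H$-bimodule map $\sigma$ with $\sigma(\omega\otimes\nu)=-\nu\otimes\omega$ for $\omega,\nu\in\{di,dj\}$. Put $s^{1,1}=\tfrac12(\mathrm{id}+\sigma):\Omega^1\otimes_{\mathbb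 H}\Omega^1\to S^2$. The quantization $q$ induced by $\nabla$ and $s^{1,1}$ is given by $$q^0=\mathrm{id},\qquad q^1(\varsigma^1(\Delta))=\tilde\Delta\circ\iota^1\circ d,\qquad q^2(\varsigma^2(\Delta))=\tilde\Delta\circ\iota^2\circ s^{1,1}\circ\nabla\circ d,\qquad q^n=0\ (n\ge3),$$ where $\iota^1:\Omega^1\to J^1\mathbb H$ and $\iota^2:S^2\to J^2\mathbb H$ are the canonical inclusions. *Star product.* Every $\Delta\in\mathrm{Diff}^N$ is uniquely $\sum_{l\le N}q^l(\Delta_l)$ with $\Delta_l\in\mathrm{Symb}^l$. For $\hbar\in\mathbb R$, the star product is the bilinear product on $\mathrm{Symb}^\bullet$ with $\sigma\star\tau=\sum_{k=0}^{n+m}\hbar^k\,\big(q^n(\sigma)\circ q^m(\tau)\big)_{n+m-k}$ for $\sigma\in\mathrm{Symb}^n$, $\tau\in\mathrm{Symb}^m$. Finally let $x_a=\varsigma^0(R_a)$, where $R_a(h)=ha$, and $p_a=\varsigma^1(\partial_a)$ for $a\in\{i,j\}$. The subalgebra generated by a set is the smallest subspace containing that set and $1$ and closed under the product. **Proposition 5.53.**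 The full quantization $q$ just described exists and is unique. For every $\hbar\in\mathbb R$ its star product satisfies, for all $a,b\in\{i,j\}$, $$x_a\star x_b=x_a\cdot x_b,\qquad p_a\star x_b=-x_b\cdot p_a+\hbar\,\delta_{a,b},\qquad x_a\star p_b=x_a\cdot p_b,\qquad p_a\star p_b=p_a\cdot p_b,$$ and $x_i,x_j,p_i,p_j$ generate $(\mathrm{Symb}^\bullet,\star)$. Moreover, for every $\hbar$, $x_i$ and $x_j$ generate a subalgebra of $(\mathrm{Symb}^\bullet,\star)$ isomorphic to $\mathbb H^{\mathrm{op}}$, and $p_i\star p_j=-p_j\star p_i$, $p_i\star p_i=p_j\star p_j=0$. The subalgebra generated by $x_i,x_j$ and the one generated by $p_i,p_j$, with their products, do not depend on $\hbar$. For $\hbar=0$ the star product is the product of the symbol algebra. -/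

import Mathlib

noncomputable section

open scoped TensorProduct

namespace QuatQuant

/-- The algebra `ℍ` of real quaternions. -/
abbrev QH : Type := Quaternion ℝ

/-- The quaternion `a + b i + c j + e k`. -/
def quat (a b c e : ℝ) : QH := ⟨a, b, c, e⟩

@[simp] theorem quat_re (a b c e : ℝ) : (quat a b c e).re = a := rfl
@[simp] theorem quat_imI (a b c e : ℝ) : (quat a b c e).imI = b := rfl
@[simp] theorem quat_imJ (a b c e : ℝ) : (quat a b c e).imJ = c := rfl
@[simp] theorem quat_imK (a b c e : ℝ) : (quat a b c e).imK = e := rfl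

@[simp] theorem one_re : (1 : QH).re = 1 := rfl
@[simp] theorem one_imI : (1 : QH).imI = 0 := rfl
@[simp] theorem one_imJ : (1 : QH).imJ = 0 := rfl
@[simp] theorem one_imK : (1 : QH).imK = 0 := rfl
@[simp] theorem zero_re : (0 : QH).re = 0 := rfl
@[simp] theorem zero_imI : (0 : QH).imI = 0 := rfl
@[simp] theorem zero_imJ : (0 : QH).imJ = 0 := rfl
@[simp] theorem zero_imK : (0 : QH).imK = 0 := rfl

/-- The quaternion units. -/
def qi : QH := quat 0 1 0 0
def qj : QH := quat 0 0 1 0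
def qk : QH := quat 0 0 0 1

/-- Conjugation by `k`, i.e. `h ↦ k h k⁻¹`, which fixes `1, k` and negates `i, j`. It is the
automorphism of `ℍ` through which the right module structure acts on the frame `di, dj`. -/
def twist : QH →+* QH where
  toFun h := quat h.re (-h.imI) (-h.imJ) h.imK
  map_one' := by apply Quaternion.ext <;> simp
  map_mul' a b := by apply Quaternion.ext <;> simp <;> ring_nf
  map_zero' := by apply Quaternion.ext <;> simp
  map_add' a b := by apply Quaternion.ext <;> simp <;> ring_nf

/-- The bimodule `Ω¹` of one-forms of the maximal `{i,j}`-terminal first order calculus on `ℍ`: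
the left module freely generated by `di` and `dj`, the pair `(a, b)` standing for `a di + b dj`.
The right action is `di h = (k h k⁻¹) di`, `dj h = (k h k⁻¹) dj` (an `ℍᵐᵒᵖ`-module structure).
This is the bimodule structure forced by `dk = -j di + i dj` and the Leibniz rule. -/
def Om : Type := QH × QH

instance : AddCommGroup Om := inferInstanceAs (AddCommGroup (QH × QH))
instance : Module QH Om := inferInstanceAs (Module QH (QH × QH))
instance : Module QHᵐᵒᵖ Om := Module.compHom (QH × QH) (RingHom.op twist)

/-- The form `a di + b dj`. -/
def Om.mk (a b : QH) : Om := ((a, b) : QH × QH)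

/-- The coefficient of `di` (left linear). -/
def Om.ci : Om →ₗ[QH] QH := LinearMap.fst QH QH QH

/-- The coefficient of `dj` (left linear). -/
def Om.cj : Om →ₗ[QH] QH := LinearMap.snd QH QH QH

@[ext] theorem Om.ext {v w : Om} (h1 : v.ci = w.ci) (h2 : v.cj = w.cj) : v = w := Prod.ext h1 h2
@[simp] theorem Om.ci_mk (a b : QH) : (Om.mk a b).ci = a := rfl
@[simp] theorem Om.cj_mk (a b : QH) : (Om.mk a b).cj = b := rfl
@[simp] theorem Om.ci_op (c : QH) (w : Om) : (MulOpposite.op c • w).ci = w.ci * twist c := rfl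
@[simp] theorem Om.cj_op (c : QH) (w : Om) : (MulOpposite.op c • w).cj = w.cj * twist c := rfl

instance : SMulCommClass QH QHᵐᵒᵖ Om where
  smul_comm a c w := by
    induction c using MulOpposite.rec' with
    | _ c => ext1 <;> simp [mul_assoc]

instance : SMulCommClass QHᵐᵒᵖ QH Om := SMulCommClass.symm _ _ _

/-- The frame `di, dj` (see `d_qi`, `d_qj`). -/
def di : Om := Om.mk 1 0
def dj : Om := Om.mk 0 1

/-- The operator `∂_i`, determined by `dh = (∂_i h) di + (∂_j h) dj`: for
`h = h₁ + h_i i + h_j j + h_k k` it is `∂_i h = h_i - h_k j`. -/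
def partialI : QH →ₗ[ℝ] QH where
  toFun h := quat h.imI 0 (-h.imK) 0
  map_add' a b := by apply Quaternion.ext <;> simp <;> ring_nf
  map_smul' c a := by apply Quaternion.ext <;> simp

/-- The operator `∂_j`, determined by `dh = (∂_i h) di + (∂_j h) dj`: for
`h = h₁ + h_i i + h_j j + h_k k` it is `∂_j h = h_j + h_k i`. -/
def partialJ : QH →ₗ[ℝ] QH where
  toFun h := quat h.imJ h.imK 0 0
  map_add' a b := by apply Quaternion.ext <;> simp
  map_smul' c a := by apply Quaternion.ext <;> simp

theorem twist_apply (h : QH) : twist h = quat h.re (-h.imI) (-h.imJ) h.imK := rfl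
theorem partialI_apply (h : QH) : partialI h = quat h.imI 0 (-h.imK) 0 := rfl
theorem partialJ_apply (h : QH) : partialJ h = quat h.imJ h.imK 0 0 := rfl

theorem partialI_mul (a b : QH) : partialI (a * b) = a * partialI b + partialI a * twist b := by
  apply Quaternion.ext <;> simp [partialI_apply, twist_apply] <;> ring
theorem partialJ_mul (a b : QH) : partialJ (a * b) = a * partialJ b + partialJ a * twist b := by
  apply Quaternion.ext <;> simp [partialJ_apply, twist_apply] <;> ring

/-- The differential `d : ℍ → Ω¹`. It satisfies the Leibniz rule (`d_mul`) and the structure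
equation `dk = -j di + i dj` (`d_qk`). -/
def d : QH →+ Om where
  toFun h := Om.mk (partialI h) (partialJ h)
  map_zero' := by ext1 <;> simp
  map_add' a b := by ext1 <;> simp

@[simp] theorem ci_d (h : QH) : (d h).ci = partialI h := rfl
@[simp] theorem cj_d (h : QH) : (d h).cj = partialJ h := rfl

theorem d_qi : d qi = di := by
  ext1 <;> apply Quaternion.ext <;> simp [di, partialI_apply, partialJ_apply, qi]
theorem d_qj : d qj = dj := by
  ext1 <;> apply Quaternion.ext <;> simp [dj, partialI_apply, partialJ_apply, qj]
theorem d_qk : d qk = -(qj • di) + qi • dj := by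
  ext1 <;> apply Quaternion.ext <;> simp [di, dj, partialI_apply, partialJ_apply, qi, qj, qk]
theorem d_one : d 1 = 0 := by
  ext1 <;> apply Quaternion.ext <;> simp [partialI_apply, partialJ_apply]

theorem d_mul (a b : QH) : d (a * b) = MulOpposite.op b • d a + a • d b := by
  ext1 <;> simp [partialI_mul, partialJ_mul, add_comm]

theorem Om.eq_comb (w : Om) : w = w.ci • di + w.cj • dj := by
  ext1 <;> simp [di, dj]

section Tensor

variable (E : Type) [AddCommGroup E] [Module QH E]

/-- The relations `(w c) ⊗ e - w ⊗ (c e)` of the tensor product over `ℍ`. -/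
def balance : Submodule QH (Om ⊗[ℤ] E) :=
  Submodule.span QH {t | ∃ (w : Om) (c : QH) (e : E),
    t = (MulOpposite.op c • w) ⊗ₜ[ℤ] e - w ⊗ₜ[ℤ] (c • e)}

/-- The tensor product `Ω¹ ⊗_ℍ E`, a left `ℍ`-module through the left action on `Ω¹`.
In particular `Ω¹ ⊗_ℍ Ω¹` is `OmT Om`, and `Ω¹ ⊗_ℍ (Ω¹ ⊗_ℍ E)` is `OmT (OmT E)`. -/
def OmT : Type := (Om ⊗[ℤ] E) ⧸ balance E

instance : AddCommGroup (OmT E) := inferInstanceAs (AddCommGroup (_ ⧸ balance E))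
instance : Module QH (OmT E) := inferInstanceAs (Module QH (_ ⧸ balance E))

end Tensor

namespace OmT

variable {E F G : Type} [AddCommGroup E] [Module QH E] [AddCommGroup F] [Module QH F]
  [AddCommGroup G]

/-- The elementary tensor `w ⊗ e`. -/
def tmul (w : Om) (e : E) : OmT E := (balance E).mkQ (w ⊗ₜ[ℤ] e)

theorem tmul_add (w : Om) (e f : E) : tmul w (e + f) = tmul w e + tmul w f := by
  simp only [tmul, TensorProduct.tmul_add, map_add]; rfl

theorem add_tmul (v w : Om) (e : E) : tmul (v + w) e = tmul v e + tmul w e := by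
  simp only [tmul, TensorProduct.add_tmul, map_add]; rfl

theorem smul_tmul (a : QH) (w : Om) (e : E) : tmul (a • w) e = a • tmul w e := rfl

theorem op_smul_tmul (c : QH) (w : Om) (e : E) :
    tmul (MulOpposite.op c • w) e = tmul w (c • e) :=
  (Submodule.Quotient.eq _).2 (Submodule.subset_span ⟨w, c, e, rfl⟩)

/-- The map `e ↦ w ⊗ e`. -/
def tmulHom (w : Om) : E →+ OmT E := AddMonoidHom.mk' (tmul w) (tmul_add w)

theorem tmul_zero (w : Om) : tmul w (0 : E) = 0 := (tmulHom w).map_zero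
theorem tmul_neg (w : Om) (e : E) : tmul w (-e) = -tmul w e := (tmulHom w).map_neg e
theorem tmul_sub (w : Om) (e f : E) : tmul w (e - f) = tmul w e - tmul w f :=
  (tmulHom w).map_sub e f

/-- The map `w ↦ w ⊗ e`. -/
def tmulHom' (e : E) : Om →+ OmT E := AddMonoidHom.mk' (fun w => tmul w e) fun v w => add_tmul v w e

theorem zero_tmul (e : E) : tmul 0 e = 0 := (tmulHom' e).map_zero
theorem neg_tmul (w : Om) (e : E) : tmul (-w) e = -tmul w e := (tmulHom' e).map_neg w

@[elab_as_elim]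
theorem induction {p : OmT E → Prop} (zero : p 0) (tmul : ∀ w e, p (tmul w e))
    (add : ∀ s t, p s → p t → p (s + t)) (t : OmT E) : p t := by
  obtain ⟨t, rfl⟩ := Submodule.mkQ_surjective _ t
  induction t using TensorProduct.induction_on with
  | zero => rw [map_zero]; exact zero
  | tmul w e => exact tmul w e
  | add s t hs ht => rw [map_add]; exact add _ _ hs ht

/-- The additive map out of `Ω¹ ⊗_ℍ E` induced by a balanced biadditive map. -/
def liftAdd (f : Om →+ E →+ G)
    (hf : ∀ (w : Om) (c : QH) (e : E), f (MulOpposite.op c • w) e = f w (c • e)) :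
    OmT E →+ G :=
  QuotientAddGroup.lift (balance E).toAddSubgroup
    (TensorProduct.liftAddHom f (by intro r w e; simp)) (by
      intro t ht
      change t ∈ balance E at ht
      have key : ∀ a : QH, TensorProduct.liftAddHom f (by intro r w e; simp) (a • t) = 0 := by
        induction ht using Submodule.span_induction with
        | mem t ht =>
          obtain ⟨w, c, e, rfl⟩ := ht
          intro a
          rw [smul_sub, map_sub, TensorProduct.smul_tmul', TensorProduct.smul_tmul',
            TensorProduct.liftAddHom_tmul, TensorProduct.liftAddHom_tmul,
            smul_comm a (MulOpposite.op c) w, hf, sub_self]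
        | zero => intro a; rw [smul_zero, map_zero]
        | add s t _ _ hs ht => intro a; rw [smul_add, map_add, hs, ht, add_zero]
        | smul b t _ ht => intro a; rw [smul_smul]; exact ht _
      simpa using key 1)

@[simp] theorem liftAdd_tmul (f : Om →+ E →+ G)
    (hf : ∀ (w : Om) (c : QH) (e : E), f (MulOpposite.op c • w) e = f w (c • e))
    (w : Om) (e : E) : liftAdd f hf (tmul w e) = f w e := rfl

variable [Module QH G]

/-- The left linear map out of `Ω¹ ⊗_ℍ E` induced by a balanced biadditive map that is left
linear in the form. -/
def lift (f : Om →+ E →+ G)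
    (hf : ∀ (w : Om) (c : QH) (e : E), f (MulOpposite.op c • w) e = f w (c • e))
    (hs : ∀ (a : QH) (w : Om) (e : E), f (a • w) e = a • f w e) : OmT E →ₗ[QH] G where
  toFun := liftAdd f hf
  map_add' := map_add _
  map_smul' a t := by
    induction t using OmT.induction with
    | zero => simp
    | tmul w e => rw [← smul_tmul]; exact hs a w e
    | add s t h1 h2 => rw [smul_add, map_add, h1, h2, map_add, smul_add]

@[simp] theorem lift_tmul (f : Om →+ E →+ G)
    (hf : ∀ (w : Om) (c : QH) (e : E), f (MulOpposite.op c • w) e = f w (c • e))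
    (hs : ∀ (a : QH) (w : Om) (e : E), f (a • w) e = a • f w e) (w : Om) (e : E) :
    lift f hf hs (tmul w e) = f w e := rfl

theorem hom_ext {M : Type} [AddCommGroup M] {f g : OmT E →+ M}
    (h : ∀ w e, f (tmul w e) = g (tmul w e)) : f = g := by
  ext t
  induction t using OmT.induction with
  | zero => simp
  | tmul w e => exact h w e
  | add s t h1 h2 => rw [map_add, h1, h2, map_add]

/-- The universal balanced map `(w, e) ↦ w ⊗ e`. -/
def tmulBi (E : Type) [AddCommGroup E] [Module QH E] : Om →+ E →+ OmT E :=
  AddMonoidHom.mk' tmulHom fun v w => by ext e; exact add_tmul v w e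

@[simp] theorem tmulBi_apply (w : Om) (e : E) : tmulBi E w e = tmul w e := rfl

/-- The map `id ⊗ f : Ω¹ ⊗_ℍ E → Ω¹ ⊗_ℍ F` for a left linear `f`. -/
def map (f : E →ₗ[QH] F) : OmT E →ₗ[QH] OmT F :=
  lift ((AddMonoidHom.compHom' f.toAddMonoidHom).comp (tmulBi F))
    (fun w c e => by simp [op_smul_tmul]) (fun a w e => by simp [smul_tmul])

@[simp] theorem map_tmul (f : E →ₗ[QH] F) (w : Om) (e : E) : map f (tmul w e) = tmul w (f e) := rfl

theorem map_map (g : F →ₗ[QH] G) (f : E →ₗ[QH] F) (t : OmT E) :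
    map g (map f t) = map (g ∘ₗ f) t := by
  induction t using OmT.induction with
  | zero => simp
  | tmul w e => rfl
  | add s t h1 h2 => simp only [map_add, h1, h2]


end OmT

section Jet

variable (E F : Type) [AddCommGroup E] [Module QH E] [AddCommGroup F] [Module QH F]

/-- The kernel of `Ω¹ ⊗ Ω¹ ⊗ E → Ω² ⊗ E`, where `Ω²` belongs to the maximal exterior algebra:
it is generated by the elements `∑ da_r ⊗ db_r ⊗ e` with `∑ a_r db_r = 0`. -/
def rel2 : Submodule QH (OmT (OmT E)) :=
  Submodule.span QH {t | ∃ (n : ℕ) (a b : Fin n → QH) (e : E),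
    ∑ r, a r • d (b r) = 0 ∧ t = ∑ r, OmT.tmul (d (a r)) (OmT.tmul (d (b r)) e)}

/-- The left module `Ω² ⊗_ℍ E`, where `Ω² = (Ω¹ ⊗ Ω¹) / ⟨∑ da_r ⊗ db_r : ∑ a_r db_r = 0⟩` are the
two-forms of the maximal exterior algebra over the calculus (`- ⊗_ℍ E` being right exact, the
quotient may be taken after tensoring). -/
def Om2 : Type := OmT (OmT E) ⧸ rel2 E

instance : AddCommGroup (Om2 E) := inferInstanceAs (AddCommGroup (_ ⧸ rel2 E))
instance : Module QH (Om2 E) := inferInstanceAs (Module QH (_ ⧸ rel2 E))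

/-- The map `∧ ⊗ id : Ω¹ ⊗ Ω¹ ⊗ E → Ω² ⊗ E`. -/
def wedge : OmT (OmT E) →ₗ[QH] Om2 E := (rel2 E).mkQ

variable {E F}

theorem wedge_rel {n : ℕ} (a b : Fin n → QH) (e : E) (h : ∑ r, a r • d (b r) = 0) :
    ∑ r, wedge E (OmT.tmul (d (a r)) (OmT.tmul (d (b r)) e)) = 0 := by
  rw [← map_sum]
  exact (Submodule.Quotient.mk_eq_zero _).2 (Submodule.subset_span ⟨n, a, b, e, h, rfl⟩)

/-- The map `id ⊗ f : Ω² ⊗_ℍ E → Ω² ⊗_ℍ F`. -/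
def Om2.map (f : E →ₗ[QH] F) : Om2 E →ₗ[QH] Om2 F :=
  Submodule.mapQ (rel2 E) (rel2 F) (OmT.map (OmT.map f)) (by
    refine Submodule.span_le.2 ?_
    rintro _ ⟨n, a, b, e, h, rfl⟩
    refine Submodule.subset_span ⟨n, a, b, f e, h, ?_⟩
    rw [map_sum]; rfl)

@[simp] theorem Om2.map_wedge (f : E →ₗ[QH] F) (t : OmT (OmT E)) :
    Om2.map f (wedge E t) = wedge F (OmT.map (OmT.map f) t) := rfl

/-- The element `dω ⊗ e` of `Ω² ⊗_ℍ E`, where `d(a di + b dj) = da ∧ di + db ∧ dj`. It satisfies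
`d ∘ d = 0` and both Leibniz rules (`extD_d`, `extD_smul`, `extD_op`). -/
def extD (w : Om) (e : E) : Om2 E :=
  wedge E (OmT.tmul (d w.ci) (OmT.tmul di e) + OmT.tmul (d w.cj) (OmT.tmul dj e))

theorem extD_add_left (v w : Om) (e : E) : extD (v + w) e = extD v e + extD w e := by
  simp only [extD, map_add, OmT.add_tmul]; abel

theorem extD_add_right (w : Om) (e f : E) : extD w (e + f) = extD w e + extD w f := by
  simp only [extD, map_add, OmT.tmul_add]; abel

theorem extD_d (h : QH) (e : E) : extD (d h) e = 0 := by
  have := wedge_rel ![1, -partialI h, -partialJ h] ![h, qi, qj] e (by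
    simp only [Fin.sum_univ_three]
    simp only [Matrix.cons_val_zero, Matrix.cons_val_one, Matrix.cons_val]
    rw [d_qi, d_qj, one_smul]
    nth_rewrite 1 [Om.eq_comb (d h)]
    simp only [ci_d, cj_d, neg_smul]
    abel)
  simp only [Fin.sum_univ_three] at this
  simp only [Matrix.cons_val_zero, Matrix.cons_val_one, Matrix.cons_val, d_one, d_qi, d_qj,
    map_neg, OmT.neg_tmul, OmT.zero_tmul, map_zero, zero_add] at this
  rw [extD, map_add, ci_d, cj_d]
  rw [← neg_eq_zero, neg_add]
  exact this

theorem wedge_gen_i (c : QH) (e : E) : wedge E (OmT.tmul (d (twist c)) (OmT.tmul di e)) =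
    -wedge E (OmT.tmul di (OmT.tmul (d c) e)) := by
  have := wedge_rel ![twist c, -1, qi] ![qi, qi * c, c] e (by
    simp only [Fin.sum_univ_three]
    simp only [Matrix.cons_val_zero, Matrix.cons_val_one, Matrix.cons_val]
    rw [d_mul, d_qi]
    have : MulOpposite.op c • di = twist c • di := by ext1 <;> simp [di]
    rw [this]; simp only [neg_smul, one_smul, smul_add]; abel)
  simp only [Fin.sum_univ_three] at this
  simp only [Matrix.cons_val_zero, Matrix.cons_val_one, Matrix.cons_val, d_one, d_qi, d_qj,
    map_neg, OmT.neg_tmul, OmT.zero_tmul, map_zero, neg_zero, add_zero] at this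
  exact eq_neg_of_add_eq_zero_left this

theorem wedge_gen_j (c : QH) (e : E) : wedge E (OmT.tmul (d (twist c)) (OmT.tmul dj e)) =
    -wedge E (OmT.tmul dj (OmT.tmul (d c) e)) := by
  have := wedge_rel ![twist c, -1, qj] ![qj, qj * c, c] e (by
    simp only [Fin.sum_univ_three]
    simp only [Matrix.cons_val_zero, Matrix.cons_val_one, Matrix.cons_val]
    rw [d_mul, d_qj]
    have : MulOpposite.op c • dj = twist c • dj := by ext1 <;> simp [dj]
    rw [this]; simp only [neg_smul, one_smul, smul_add]; abel)
  simp only [Fin.sum_univ_three] at this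
  simp only [Matrix.cons_val_zero, Matrix.cons_val_one, Matrix.cons_val, d_one, d_qi, d_qj,
    map_neg, OmT.neg_tmul, OmT.zero_tmul, map_zero, neg_zero, add_zero] at this
  exact eq_neg_of_add_eq_zero_left this

theorem smul_di (a c : QH) (e : E) : OmT.tmul (a • di) (c • e) = OmT.tmul ((a * twist c) • di) e := by
  rw [← OmT.op_smul_tmul]; congr 1; ext1 <;> simp [di]

theorem smul_dj (a c : QH) (e : E) : OmT.tmul (a • dj) (c • e) = OmT.tmul ((a * twist c) • dj) e := by
  rw [← OmT.op_smul_tmul]; congr 1; ext1 <;> simp [dj]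

theorem extD_op (w : Om) (c : QH) (e : E) :
    extD (MulOpposite.op c • w) e = extD w (c • e) - wedge E (OmT.tmul w (OmT.tmul (d c) e)) := by
  have hi := smul_di (E := E) 1 c e
  have hj := smul_dj (E := E) 1 c e
  rw [one_smul, one_mul] at hi hj
  have hw : wedge E (OmT.tmul w (OmT.tmul (d c) e)) =
      w.ci • wedge E (OmT.tmul di (OmT.tmul (d c) e)) +
        w.cj • wedge E (OmT.tmul dj (OmT.tmul (d c) e)) := by
    nth_rewrite 1 [Om.eq_comb w]
    simp only [OmT.add_tmul, OmT.smul_tmul, map_add, map_smul]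
  rw [extD, extD, Om.ci_op, Om.cj_op, d_mul, d_mul, hi, hj, hw]
  simp only [OmT.add_tmul, OmT.op_smul_tmul, map_add, OmT.smul_tmul, map_smul, wedge_gen_i,
    wedge_gen_j, smul_neg]
  abel

theorem extD_smul (a : QH) (w : Om) (e : E) :
    extD (a • w) e = wedge E (OmT.tmul (d a) (OmT.tmul w e)) + a • extD w e := by
  rw [extD, extD]
  nth_rewrite 3 [Om.eq_comb w]
  simp only [map_smul, smul_eq_mul, d_mul, OmT.add_tmul, OmT.op_smul_tmul, map_add, OmT.smul_tmul,
    OmT.tmul_add, smul_add, smul_smul]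
  abel

end Jet

section J1

variable (E F : Type) [AddCommGroup E] [Module QH E] [AddCommGroup F] [Module QH F]

/-- The 1-jet module `J¹E = J¹ℍ ⊗_ℍ E`. The splitting of `0 → Ω¹ ⊗ E → J¹E → E → 0` by the
prolongation `e ↦ j¹(e)` identifies it as an additive group with `(Ω¹ ⊗ E) × E`, the pair `(w, e)`
standing for `ι¹(w) + j¹(e)`. The left action is then determined by `j¹(a e) = a j¹(e) + ι¹(da ⊗ e)`.
In terms of `J¹ℍ ⊆ ℍ ⊗ ℍ` modulo the kernel of `x ⊗ y ↦ x dy`, `[x ⊗ y] ⊗ e = x j¹(y e)`. -/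
def J1 : Type := OmT E × E

instance : AddCommGroup (J1 E) := inferInstanceAs (AddCommGroup (OmT E × E))

variable {E F}

def J1.mk (w : OmT E) (e : E) : J1 E := ((w, e) : OmT E × E)

/-- The component in `Ω¹ ⊗ E`. -/
def J1.form : J1 E →+ OmT E := AddMonoidHom.fst (OmT E) E

/-- The component in `E`. -/
def J1.pt : J1 E →+ E := AddMonoidHom.snd (OmT E) E

@[simp] theorem J1.form_mk (w : OmT E) (e : E) : (J1.mk w e).form = w := rfl
@[simp] theorem J1.pt_mk (w : OmT E) (e : E) : (J1.mk w e).pt = e := rfl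
@[ext] theorem J1.ext {x y : J1 E} (h1 : x.form = y.form) (h2 : x.pt = y.pt) : x = y :=
  Prod.ext h1 h2

instance : SMul QH (J1 E) where
  smul a x := J1.mk (a • x.form - OmT.tmul (d a) x.pt) (a • x.pt)

@[simp] theorem J1.form_smul (a : QH) (x : J1 E) :
    (a • x).form = a • x.form - OmT.tmul (d a) x.pt := rfl
@[simp] theorem J1.pt_smul (a : QH) (x : J1 E) : (a • x).pt = a • x.pt := rfl

instance : Module QH (J1 E) where
  one_smul x := by ext1 <;> simp [d_one, OmT.zero_tmul]
  mul_smul a b x := by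
    ext1
    · simp [d_mul, OmT.add_tmul, OmT.op_smul_tmul, OmT.smul_tmul, mul_smul, smul_sub]
      abel
    · simp [mul_smul]
  smul_zero a := by ext1 <;> simp [OmT.tmul_zero]
  smul_add a x y := by
    ext1
    · simp [OmT.tmul_add]; abel
    · simp
  add_smul a b x := by
    ext1
    · simp [OmT.add_tmul, add_smul]; abel
    · simp [add_smul]
  zero_smul x := by ext1 <;> simp [OmT.zero_tmul]

/-- The jet projection `J¹E → E`. -/
def J1.proj : J1 E →ₗ[QH] E where
  toFun := J1.pt
  map_add' := map_add _
  map_smul' _ _ := rfl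

@[simp] theorem J1.proj_apply (x : J1 E) : J1.proj x = x.pt := rfl

/-- The inclusion `ι¹ : Ω¹ ⊗ E → J¹E`. -/
def J1.incl : OmT E →ₗ[QH] J1 E where
  toFun w := J1.mk w 0
  map_add' v w := by ext1 <;> simp
  map_smul' a w := by ext1 <;> simp [OmT.tmul_zero]

@[simp] theorem J1.form_incl (w : OmT E) : (J1.incl w).form = w := rfl
@[simp] theorem J1.pt_incl (w : OmT E) : (J1.incl w).pt = 0 := rfl

/-- The prolongation `j¹ : E → J¹E`. -/
def J1.prolong : E →+ J1 E where
  toFun e := J1.mk 0 e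
  map_zero' := rfl
  map_add' e f := by ext1 <;> simp

@[simp] theorem J1.form_prolong (e : E) : (J1.prolong e).form = 0 := rfl
@[simp] theorem J1.pt_prolong (e : E) : (J1.prolong e).pt = e := rfl

/-- The functor `J¹` on left linear maps; it sends `j¹(e)` to `j¹(f e)` and is `id ⊗ f` on
`Ω¹ ⊗ E`. -/
def J1.map (f : E →ₗ[QH] F) : J1 E →ₗ[QH] J1 F where
  toFun x := J1.mk (OmT.map f x.form) (f x.pt)
  map_add' x y := by ext1 <;> simp
  map_smul' a x := by ext1 <;> simp

@[simp] theorem J1.form_map (f : E →ₗ[QH] F) (x : J1 E) :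
    (J1.map f x).form = OmT.map f x.form := rfl
@[simp] theorem J1.pt_map (f : E →ₗ[QH] F) (x : J1 E) : (J1.map f x).pt = f x.pt := rfl

theorem J1.map_prolong (f : E →ₗ[QH] F) (e : E) : J1.map f (J1.prolong e) = J1.prolong (f e) := by
  ext1 <;> simp

/-- The Spencer operator `J¹E → Ω¹ ⊗ E`, `a j¹(e) ↦ da ⊗ e`; it vanishes exactly on the
prolongations `j¹(e)`. -/
def spencer0 : J1 E →+ OmT E := -J1.form

/-- The Spencer operator `Ω¹ ⊗ J¹E → Ω² ⊗ E`,
`ω ⊗ ξ ↦ dω ⊗ π(ξ) - ω ∧ D(ξ)`, where `D` is the Spencer operator of `J¹E` and `π` the jet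
projection. -/
def spencer1 : OmT (J1 E) →+ Om2 E :=
  OmT.liftAdd
    (AddMonoidHom.mk'
      (fun w => AddMonoidHom.mk'
        (fun x => extD w x.pt - wedge E (OmT.tmul w (spencer0 x)))
        (fun x y => by
          simp only [map_add, extD_add_right, OmT.tmul_add]; abel))
      (fun v w => by
        ext x
        simp only [AddMonoidHom.mk'_apply, AddMonoidHom.add_apply, extD_add_left, OmT.add_tmul,
          map_add]
        abel))
    (fun w c x => by
      simp only [AddMonoidHom.mk'_apply, extD_op, spencer0, AddMonoidHom.neg_apply,
        J1.form_smul, J1.pt_smul, OmT.op_smul_tmul, neg_sub, smul_neg, OmT.tmul_sub, OmT.tmul_neg,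
        map_sub, map_neg]
      abel)

@[simp] theorem spencer1_tmul (w : Om) (x : J1 E) :
    spencer1 (OmT.tmul w x) = extD w x.pt - wedge E (OmT.tmul w (spencer0 x)) := rfl

theorem spencer1_smul (a : QH) (t : OmT (J1 E)) :
    spencer1 (a • t) = wedge E (OmT.tmul (d a) (OmT.map J1.proj t)) + a • spencer1 t := by
  induction t using OmT.induction with
  | zero => simp [OmT.tmul_zero]
  | tmul w x =>
    rw [← OmT.smul_tmul, spencer1_tmul, spencer1_tmul, extD_smul, OmT.map_tmul, OmT.smul_tmul,
      map_smul, smul_sub, J1.proj_apply]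
    abel
  | add s t h1 h2 =>
    simp only [smul_add, map_add, h1, h2, OmT.tmul_add]
    abel

theorem extD_map (f : E →ₗ[QH] F) (w : Om) (e : E) : Om2.map f (extD w e) = extD w (f e) := by
  simp [extD]

theorem spencer1_map (f : E →ₗ[QH] F) (t : OmT (J1 E)) :
    spencer1 (OmT.map (J1.map f) t) = Om2.map f (spencer1 t) := by
  induction t using OmT.induction with
  | zero => simp
  | tmul w x => simp [extD_map, spencer0]
  | add s t h1 h2 => simp only [map_add, h1, h2]

/-- The holonomic 2-jets `J²E ⊆ J¹(J¹E)`: those on which the two projections to `J¹E` agree and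
which the Spencer operators send to zero in `Ω² ⊗ E`. -/
def hol (E : Type) [AddCommGroup E] [Module QH E] : Submodule QH (J1 (J1 E)) where
  carrier := {x | J1.map J1.proj x = J1.proj x ∧ spencer1 (spencer0 x) = 0}
  zero_mem' := by simp
  add_mem' := by
    rintro x y ⟨hx, hx'⟩ ⟨hy, hy'⟩
    exact ⟨by rw [map_add, map_add, hx, hy], by rw [map_add, map_add, hx', hy', add_zero]⟩
  smul_mem' := by
    rintro a x ⟨hx, hx'⟩
    refine ⟨by rw [map_smul, map_smul, hx], ?_⟩
    have h1 : spencer0 (a • x) = OmT.tmul (d a) x.pt + a • spencer0 x := by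
      simp only [spencer0, AddMonoidHom.neg_apply, J1.form_smul, smul_neg]; abel
    have h2 : OmT.map J1.proj x.form = x.pt.form := congrArg J1.form hx
    rw [h1, map_add, spencer1_smul, hx', smul_zero, add_zero, spencer1_tmul, extD_d, spencer0,
      spencer0, AddMonoidHom.neg_apply, AddMonoidHom.neg_apply, map_neg, h2]
    abel

theorem hol_map (f : E →ₗ[QH] F) {x : J1 (J1 E)} (hx : x ∈ hol E) :
    J1.map (J1.map f) x ∈ hol F := by
  obtain ⟨h1, h2⟩ := hx
  refine ⟨?_, ?_⟩
  · have : J1.proj (J1.map (J1.map f) x) = J1.map f (J1.proj x) := rfl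
    rw [this, ← h1]
    ext1
    · simp only [J1.form_map, OmT.map_map]; rfl
    · rfl
  · have : spencer0 (J1.map (J1.map f) x) = OmT.map (J1.map f) (spencer0 x) := by
      simp [spencer0]
    rw [this, spencer1_map, h2, map_zero]

theorem hol_prolong (e : E) : J1.prolong (J1.prolong e) ∈ hol E :=
  ⟨by ext1 <;> simp, by simp [spencer0]⟩

end J1

/-- Two consecutive jet modules `X = JⁿE` and `Y = Jⁿ⁺¹E` together with the canonical map
`l : Jⁿ⁺¹E → J¹(JⁿE)` and the prolongations, used to define the jet modules by recursion. -/
structure JetStage (E : Type) [AddCommGroup E] [Module QH E] where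
  X : Type
  Y : Type
  [gX : AddCommGroup X]
  [mX : Module QH X]
  [gY : AddCommGroup Y]
  [mY : Module QH Y]
  l : Y →ₗ[QH] J1 X
  jX : E →+ X
  jY : E →+ Y
  l_jY : ∀ e, l (jY e) = J1.prolong (jX e)

attribute [instance] JetStage.gX JetStage.mX JetStage.gY JetStage.mY

section Stage

variable {E F : Type} [AddCommGroup E] [Module QH E] [AddCommGroup F] [Module QH F]

/-- `Jⁿ⁺²E` is the preimage of the holonomic 2-jets `J²(JⁿE)` under `J¹(l) : J¹(Jⁿ⁺¹E) → J¹(J¹(JⁿE))`. -/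
def JetStage.next (S : JetStage E) : Submodule QH (J1 S.Y) := (hol S.X).comap (J1.map S.l)

/-- One step of the recursion. -/
def JetStage.step (S : JetStage E) : JetStage E where
  X := S.Y
  Y := S.next
  l := S.next.subtype
  jX := S.jY
  jY := AddMonoidHom.mk' (fun e => ⟨J1.prolong (S.jY e), by
      change J1.map S.l _ ∈ hol S.X
      rw [J1.map_prolong, S.l_jY]; exact hol_prolong _⟩)
    (fun e f => Subtype.ext (by simp))
  l_jY _ := rfl

/-- The sequence of jet modules, starting with `J⁰E = E` and `J¹E`. The next one is `J²E`, the
holonomic 2-jets, then `Jⁿ⁺²E = J¹(Jⁿ⁺¹E) ∩ J²(JⁿE)`. -/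
def stage (E : Type) [AddCommGroup E] [Module QH E] : ℕ → JetStage E
  | 0 => { X := E, Y := J1 E, l := LinearMap.id, jX := AddMonoidHom.id E, jY := J1.prolong
           l_jY := fun _ => rfl }
  | n + 1 => (stage E n).step

/-- The `n`-jet module `JⁿE`. -/
abbrev Jet (E : Type) [AddCommGroup E] [Module QH E] (n : ℕ) : Type := (stage E n).X

/-- The `n`-jet prolongation `jⁿ : E → JⁿE`. -/
def jet (n : ℕ) : E →+ Jet E n := (stage E n).jX

/-- The jet projection `Jⁿ⁺¹E → JⁿE`. -/
def jetProj (n : ℕ) : Jet E (n + 1) →ₗ[QH] Jet E n := J1.proj ∘ₗ (stage E n).l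

theorem jetProj_jet (n : ℕ) (e : E) : jetProj n (jet (n + 1) e) = jet n e := by
  change J1.proj ((stage E n).l ((stage E n).jY e)) = _
  rw [(stage E n).l_jY]; rfl

/-- A map that prolongs the additive map `Δ` to the two jet modules of a stage; an auxiliary
notion for the proof that differential operators compose. -/
def StageHom (Δ : E →+ F) (S : JetStage E) (T : JetStage F) : Prop :=
  ∃ (f : S.X →ₗ[QH] T.X) (g : S.Y →ₗ[QH] T.Y), (∀ y, T.l (g y) = J1.map f (S.l y)) ∧
    (∀ e, f (S.jX e) = T.jX (Δ e)) ∧ ∀ e, g (S.jY e) = T.jY (Δ e)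

theorem StageHom.step {Δ : E →+ F} {S : JetStage E} {T : JetStage F} (h : StageHom Δ S T) :
    StageHom Δ S.step T.step := by
  obtain ⟨f, g, h1, h2, h3⟩ := h
  have hmem : ∀ y : S.next, J1.map g y.1 ∈ T.next := by
    intro y
    change J1.map T.l (J1.map g y.1) ∈ hol T.X
    have : J1.map T.l (J1.map g y.1) = J1.map (J1.map f) (J1.map S.l y.1) := by
      ext1
      · simp only [J1.form_map, OmT.map_map]
        congr 2; ext1 z; exact h1 z
      · exact h1 _
    rw [this]; exact hol_map f y.2
  refine ⟨g, LinearMap.codRestrict T.next (J1.map g ∘ₗ S.next.subtype) hmem, fun y => rfl, h3, ?_⟩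
  intro e
  apply Subtype.ext
  change J1.map g (J1.prolong (S.jY e)) = J1.prolong (T.jY (Δ e))
  rw [J1.map_prolong, h3]

theorem stageHom_stage {Δ : E →+ F} {m : ℕ} (φ : Jet E m →ₗ[QH] F) (h : ∀ e, φ (jet m e) = Δ e)
    (n : ℕ) : StageHom Δ (stage E (m + n)) (stage F n) := by
  induction n with
  | zero =>
    refine ⟨φ, J1.map φ ∘ₗ (stage E m).l, fun y => rfl, h, fun e => ?_⟩
    change J1.map φ ((stage E m).l ((stage E m).jY e)) = J1.prolong (Δ e)
    rw [(stage E m).l_jY, J1.map_prolong]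
    congr 1; exact h e
  | succ n ih => exact ih.step

end Stage

section DiffOps

instance : AddCommGroup (QH →ₗ[ℝ] QH) :=
  { LinearMap.addCommMonoid (M := QH) (M₂ := QH) (σ₁₂ := RingHom.id ℝ),
    (LinearMap.addCommGroup : AddCommGroup (QH →ₗ[ℝ] QH)) with }

/-- The linear differential operators `Diffⁿ(ℍ, ℍ)` of order at most `n`: the `ℝ`-linear maps
`Δ : ℍ → ℍ` that factor as `Δ = φ ∘ jⁿ` with `φ : Jⁿℍ → ℍ` left `ℍ`-linear. -/
def DiffOp (n : ℕ) : Submodule ℝ (QH →ₗ[ℝ] QH) where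
  carrier := {Δ | ∃ φ : Jet QH n →ₗ[QH] QH, ∀ h, φ (jet n h) = Δ h}
  zero_mem' := ⟨0, fun _ => rfl⟩
  add_mem' := by
    rintro _ _ ⟨φ, hφ⟩ ⟨ψ, hψ⟩
    exact ⟨φ + ψ, fun h => by simp [hφ, hψ]⟩
  smul_mem' := by
    rintro c _ ⟨φ, hφ⟩
    exact ⟨c • φ, fun h => by simp [hφ]⟩

theorem DiffOp.le_succ (n : ℕ) : DiffOp n ≤ DiffOp (n + 1) := by
  rintro _ ⟨φ, hφ⟩
  exact ⟨φ ∘ₗ jetProj n, fun h => by rw [LinearMap.comp_apply, jetProj_jet, hφ]⟩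

theorem DiffOp.mono : Monotone DiffOp := monotone_nat_of_le_succ DiffOp.le_succ

theorem DiffOp.comp_mem {n m : ℕ} {Δ₁ Δ₂ : QH →ₗ[ℝ] QH} (h₁ : Δ₁ ∈ DiffOp n)
    (h₂ : Δ₂ ∈ DiffOp m) : Δ₁ ∘ₗ Δ₂ ∈ DiffOp (n + m) := by
  obtain ⟨φ, hφ⟩ := h₁
  obtain ⟨ψ, hψ⟩ := h₂
  obtain ⟨f, -, -, hf, -⟩ := stageHom_stage (Δ := Δ₂.toAddMonoidHom) ψ hψ n
  rw [add_comm]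
  exact ⟨φ ∘ₗ f, fun h => (congrArg φ (hf h)).trans (hφ _)⟩

/-- Composition of differential operators. -/
def comp (n m : ℕ) : DiffOp n →ₗ[ℝ] DiffOp m →ₗ[ℝ] DiffOp (n + m) :=
  LinearMap.mk₂ ℝ (fun Δ₁ Δ₂ => ⟨Δ₁.1 ∘ₗ Δ₂.1, DiffOp.comp_mem Δ₁.2 Δ₂.2⟩)
    (fun _ _ _ => rfl) (fun _ _ _ => rfl)
    (fun _ _ _ => Subtype.ext (by simp [LinearMap.comp_add]))
    (fun _ _ _ => Subtype.ext (by simp [LinearMap.comp_smul]))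

/-- Composition of a differential operator with a left `ℍ`-linear map. -/
def postComp (ψ : QH →ₗ[QH] QH) (n : ℕ) : DiffOp n →ₗ[ℝ] DiffOp n where
  toFun Δ := ⟨ψ.restrictScalars ℝ ∘ₗ Δ.1, by
    obtain ⟨φ, hφ⟩ := Δ.2
    exact ⟨ψ ∘ₗ φ, fun h => congrArg ψ (hφ h)⟩⟩
  map_add' _ _ := Subtype.ext (by simp [LinearMap.comp_add])
  map_smul' _ _ := Subtype.ext (by simp [LinearMap.comp_smul])

/-- `Diffⁿ⁻¹`, with `Diff⁻¹ = 0`. -/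
def lowerOrder : ℕ → Submodule ℝ (QH →ₗ[ℝ] QH)
  | 0 => ⊥
  | n + 1 => DiffOp n

theorem lowerOrder_comp_left {n m : ℕ} {Δ₁ Δ₂ : QH →ₗ[ℝ] QH} (h₁ : Δ₁ ∈ lowerOrder n)
    (h₂ : Δ₂ ∈ DiffOp m) : Δ₁ ∘ₗ Δ₂ ∈ lowerOrder (n + m) := by
  cases n with
  | zero => rw [(Submodule.mem_bot ℝ).1 h₁, LinearMap.zero_comp]; exact zero_mem _
  | succ n => rw [Nat.succ_add]; exact DiffOp.comp_mem h₁ h₂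

theorem lowerOrder_comp_right {n m : ℕ} {Δ₁ Δ₂ : QH →ₗ[ℝ] QH} (h₁ : Δ₁ ∈ DiffOp n)
    (h₂ : Δ₂ ∈ lowerOrder m) : Δ₁ ∘ₗ Δ₂ ∈ lowerOrder (n + m) := by
  cases m with
  | zero => rw [(Submodule.mem_bot ℝ).1 h₂, LinearMap.comp_zero]; exact zero_mem _
  | succ m => exact DiffOp.comp_mem h₁ h₂

/-- `Diffⁿ⁻¹` as a subspace of `Diffⁿ`. -/
abbrev symbKer (n : ℕ) : Submodule ℝ (DiffOp n) := (lowerOrder n).comap (DiffOp n).subtype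

/-- The symbols `Symbⁿ(ℍ, ℍ) = Diffⁿ / Diffⁿ⁻¹` of order `n`. -/
def Symb (n : ℕ) : Type := DiffOp n ⧸ symbKer n

instance (n : ℕ) : AddCommGroup (Symb n) := inferInstanceAs (AddCommGroup (DiffOp n ⧸ symbKer n))
instance (n : ℕ) : Module ℝ (Symb n) := inferInstanceAs (Module ℝ (DiffOp n ⧸ symbKer n))

/-- The symbol map `ςⁿ : Diffⁿ → Symbⁿ`. -/
def symb (n : ℕ) : DiffOp n →ₗ[ℝ] Symb n := (symbKer n).mkQ

/-- The graded space of symbols `⨁ₙ Symbⁿ(ℍ, ℍ)`. -/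
abbrev SymbAlg : Type := DirectSum ℕ Symb

/-- The inclusion of `Symbⁿ` into the graded space. -/
def inDeg (n : ℕ) : Symb n →ₗ[ℝ] SymbAlg := DirectSum.lof ℝ ℕ Symb n

/-- The bilinear extension to the graded space of a family of bilinear maps on homogeneous
components. -/
def bilinExt (f : ∀ n m, Symb n →ₗ[ℝ] Symb m →ₗ[ℝ] SymbAlg) :
    SymbAlg →ₗ[ℝ] SymbAlg →ₗ[ℝ] SymbAlg :=
  DirectSum.toModule ℝ ℕ _ fun n =>
    (DirectSum.toModule ℝ ℕ _ fun m => (f n m).flip).flip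

theorem bilinExt_inDeg (f : ∀ n m, Symb n →ₗ[ℝ] Symb m →ₗ[ℝ] SymbAlg) (n m : ℕ)
    (σ : Symb n) (τ : Symb m) : bilinExt f (inDeg n σ) (inDeg m τ) = f n m σ τ := by
  simp [bilinExt, inDeg, DirectSum.toModule_lof]

/-- The product of homogeneous symbols, induced by composition of operators:
`ςⁿ(Δ₁) · ςᵐ(Δ₂) = ςⁿ⁺ᵐ(Δ₁ ∘ Δ₂)`. -/
def symbMulHom (n m : ℕ) : Symb n →ₗ[ℝ] Symb m →ₗ[ℝ] Symb (n + m) :=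
  Submodule.liftQ (symbKer n)
    (LinearMap.flip (Submodule.liftQ (symbKer m) ((comp n m).compr₂ (symb (n + m))).flip (by
      intro Δ₂ h₂
      refine LinearMap.ext fun Δ₁ => (Submodule.Quotient.mk_eq_zero _).2 ?_
      exact lowerOrder_comp_right Δ₁.2 h₂)))
    (by
      intro Δ₁ h₁
      refine LinearMap.ext fun τ => ?_
      obtain ⟨Δ₂, rfl⟩ := Submodule.mkQ_surjective _ τ
      exact (Submodule.Quotient.mk_eq_zero _).2 (lowerOrder_comp_left h₁ Δ₂.2))

theorem symbMulHom_symb (n m : ℕ) (Δ₁ : DiffOp n) (Δ₂ : DiffOp m) :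
    symbMulHom n m (symb n Δ₁) (symb m Δ₂) = symb (n + m) (comp n m Δ₁ Δ₂) := rfl

/-- The product `·` of the symbol algebra. -/
def symbMul : SymbAlg →ₗ[ℝ] SymbAlg →ₗ[ℝ] SymbAlg :=
  bilinExt fun n m => (symbMulHom n m).compr₂ (inDeg (n + m))

/-- A full quantization for `(ℍ, ℍ)`: for each `n` a linear section `qⁿ : Symbⁿ → Diffⁿ` of the
symbol map that is linear over the left `ℍ`-linear endomorphisms of the target. -/
structure FullQuantization where
  q : ∀ n, Symb n →ₗ[ℝ] DiffOp n
  symb_q : ∀ n σ, symb n (q n σ) = σ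
  q_postComp : ∀ (ψ : QH →ₗ[QH] QH) (n : ℕ) (Δ : DiffOp n),
    q n (symb n (postComp ψ n Δ)) = postComp ψ n (q n (symb n Δ))

namespace FullQuantization

variable (Q : FullQuantization)

/-- The operator `Δ - qⁿ⁺¹(ςⁿ⁺¹(Δ))`, for `Δ` of order at most `n + 1`; it has order at most `n`. -/
def truncStep (n : ℕ) : DiffOp (n + 1) →ₗ[ℝ] DiffOp n where
  toFun Δ := ⟨Δ.1 - (Q.q (n + 1) (symb (n + 1) Δ)).1, by
    have h : symb (n + 1) (Δ - Q.q (n + 1) (symb (n + 1) Δ)) = 0 := by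
      rw [map_sub, Q.symb_q, sub_self]
    exact (Submodule.Quotient.mk_eq_zero (symbKer (n + 1))).1 h⟩
  map_add' _ _ := Subtype.ext (by simp; abel)
  map_smul' _ _ := Subtype.ext (by simp [smul_sub])

/-- The truncation to order `k` of an operator of order at most `k + r`: the components of order
`k + r, …, k + 1` are removed in turn. -/
def truncAux (k : ℕ) : (r : ℕ) → DiffOp (k + r) →ₗ[ℝ] DiffOp k
  | 0 => LinearMap.id
  | r + 1 => truncAux k r ∘ₗ Q.truncStep (k + r)

/-- The truncation to order `k` of an operator of order at most `N`. -/
def trunc (N k : ℕ) : DiffOp N →ₗ[ℝ] DiffOp k :=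
  Q.truncAux k N ∘ₗ Submodule.inclusion (DiffOp.mono (Nat.le_add_left N k))

/-- The symbol of order `k` in the decomposition `Δ = ∑ₖ qᵏ(σₖ)` of an operator of order at
most `N`, i.e. the `k`-th symbol of the truncation of `Δ` to order `k`. -/
def symbComp (N k : ℕ) : DiffOp N →ₗ[ℝ] Symb k := symb k ∘ₗ Q.trunc N k

/-- The star product of homogeneous symbols: if `qⁿ(σ) ∘ qᵐ(τ) = ∑ₗ qˡ(σₗ)`, then
`σ ⋆ τ = ∑ₖ ħᵏ σ_{n+m-k}`. -/
def starHom (ħ : ℝ) (n m : ℕ) : Symb n →ₗ[ℝ] Symb m →ₗ[ℝ] SymbAlg :=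
  ((comp n m).compl₁₂ (Q.q n) (Q.q m)).compr₂
    (∑ k ∈ Finset.range (n + m + 1), ħ ^ k • inDeg (n + m - k) ∘ₗ Q.symbComp (n + m) (n + m - k))

theorem starHom_apply (ħ : ℝ) (n m : ℕ) (σ : Symb n) (τ : Symb m) :
    Q.starHom ħ n m σ τ = ∑ k ∈ Finset.range (n + m + 1),
      ħ ^ k • inDeg (n + m - k) (Q.symbComp (n + m) (n + m - k) (comp n m (Q.q n σ) (Q.q m τ))) := by
  simp [starHom]

/-- The star product `⋆` with parameter `ħ` on the space of symbols. -/
def star (ħ : ℝ) : SymbAlg →ₗ[ℝ] SymbAlg →ₗ[ℝ] SymbAlg := bilinExt (Q.starHom ħ)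

end FullQuantization

/-- The right multiplication operator `R_c(h) = h c`, of order zero. -/
def rightMulOp (c : QH) : DiffOp 0 :=
  ⟨(LinearMap.toSpanSingleton QH QH c).restrictScalars ℝ,
    LinearMap.toSpanSingleton QH QH c, fun _ => rfl⟩

theorem rightMulOp_apply (c h : QH) : (rightMulOp c).1 h = h * c := rfl

theorem partial_mem (c : Om →ₗ[QH] QH) (Δ : QH →ₗ[ℝ] QH) (hc : ∀ h, c (d h) = Δ h)
    (hop : ∀ (w : Om) (h : QH), c (MulOpposite.op h • w) = c w * twist h) : Δ ∈ DiffOp 1 := by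
  let f : OmT QH →ₗ[QH] QH := OmT.lift
    (AddMonoidHom.mk' (fun w => AddMonoidHom.mk' (fun e => c w * twist e)
      (fun x y => by rw [map_add, mul_add])) (fun v w => by ext1 x; simp [add_mul]))
    (fun w a e => by simp [hop, mul_assoc]) (fun a w e => by simp [mul_assoc])
  let φ : J1 QH →ₗ[QH] QH :=
    { toFun := fun x => f x.form + Δ x.pt
      map_add' := fun x y => by simp only [map_add]; abel
      map_smul' := fun a x => by
        have h1 : Δ (a * x.pt) = a * Δ x.pt + Δ a * twist x.pt := by
          rw [← hc, d_mul, map_add, hop, map_smul, hc, hc, add_comm, smul_eq_mul]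
        have h2 : f (OmT.tmul (d a) x.pt) = Δ a * twist x.pt := by
          change c (d a) * twist x.pt = _
          rw [hc]
        simp only [J1.form_smul, J1.pt_smul, map_sub, map_smul, smul_eq_mul, h1, h2,
          RingHom.id_apply, mul_add]
        abel }
  exact ⟨φ, fun h => by
    change f (J1.prolong h).form + Δ h = Δ h
    simp⟩

/-- The operators `∂_i` (index `0`) and `∂_j` (index `1`), of order at most one. -/
def partialD : Fin 2 → DiffOp 1
  | 0 => ⟨partialI, partial_mem Om.ci partialI (fun _ => rfl) (fun _ _ => rfl)⟩
  | 1 => ⟨partialJ, partial_mem Om.cj partialJ (fun _ => rfl) (fun _ _ => rfl)⟩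

end DiffOps

section Connection

/-- The right action of `c` on forms, as a left linear map; thus `OmT.map (Om.rmul c)` is the right
action of `c` on `Ω¹ ⊗ Ω¹`. -/
def Om.rmul (c : QH) : Om →ₗ[QH] Om where
  toFun w := MulOpposite.op c • w
  map_add' := smul_add _
  map_smul' a w := smul_comm _ a w

@[simp] theorem Om.rmul_apply (c : QH) (w : Om) : Om.rmul c w = MulOpposite.op c • w := rfl

/-- A bimodule connection on `Ω¹`: a left connection `∇ : Ω¹ → Ω¹ ⊗ Ω¹` together with a bimodule map
`σ : Ω¹ ⊗ Ω¹ → Ω¹ ⊗ Ω¹`, its generalized braiding, with `∇(w c) = ∇(w) c + σ(w ⊗ dc)`. -/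
structure BimoduleConnection where
  nabla : Om →+ OmT Om
  sigma : OmT Om →ₗ[QH] OmT Om
  nabla_smul : ∀ (a : QH) (w : Om), nabla (a • w) = OmT.tmul (d a) w + a • nabla w
  sigma_right : ∀ (c : QH) (t : OmT Om),
    sigma (OmT.map (Om.rmul c) t) = OmT.map (Om.rmul c) (sigma t)
  nabla_op : ∀ (c : QH) (w : Om),
    nabla (MulOpposite.op c • w) = OmT.map (Om.rmul c) (nabla w) + sigma (OmT.tmul w (d c))

/-- The map `a di + b dj ↦ (k a k⁻¹) di + (k b k⁻¹) dj`. -/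
def Om.tw : Om →+ Om where
  toFun w := Om.mk (twist w.ci) (twist w.cj)
  map_zero' := by ext1 <;> simp
  map_add' v w := by ext1 <;> simp

theorem twist_twist (h : QH) : twist (twist h) = h := by
  apply Quaternion.ext <;> simp [twist_apply]

theorem Om.tw_smul (a : QH) (w : Om) : Om.tw (a • w) = twist a • Om.tw w := by
  ext1 <;> simp [Om.tw]

theorem Om.tw_op (c : QH) (w : Om) : Om.tw (MulOpposite.op c • w) = MulOpposite.op (twist c) • Om.tw w := by
  ext1 <;> simp [Om.tw]

/-- The braiding, the bimodule map with `ω ⊗ ν ↦ -ν ⊗ ω` for `ω, ν ∈ {di, dj}`. -/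
def braiding : OmT Om →ₗ[QH] OmT Om :=
  OmT.lift
    (AddMonoidHom.mk' (fun w => AddMonoidHom.mk'
        (fun v => -(w.ci • OmT.tmul (Om.tw v) di + w.cj • OmT.tmul (Om.tw v) dj))
        (fun x y => by simp only [map_add, OmT.add_tmul, smul_add]; abel))
      (fun v w => by
        ext1 x
        simp only [AddMonoidHom.mk'_apply, AddMonoidHom.add_apply, map_add, add_smul]; abel))
    (fun w c v => by
      simp only [AddMonoidHom.mk'_apply, Om.ci_op, Om.cj_op, Om.tw_smul, OmT.smul_tmul, mul_smul])
    (fun a w v => by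
      simp only [AddMonoidHom.mk'_apply, map_smul, smul_eq_mul, mul_smul, smul_neg, smul_add])

theorem braiding_tmul (w v : Om) : braiding (OmT.tmul w v) =
    -(w.ci • OmT.tmul (Om.tw v) di + w.cj • OmT.tmul (Om.tw v) dj) := rfl

theorem op_di (c : QH) : MulOpposite.op c • di = twist c • di := by ext1 <;> simp [di]
theorem op_dj (c : QH) : MulOpposite.op c • dj = twist c • dj := by ext1 <;> simp [dj]
theorem tw_di : Om.tw di = di := by ext1 <;> simp [di, Om.tw]
theorem tw_dj : Om.tw dj = dj := by ext1 <;> simp [dj, Om.tw]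

theorem d_twist (c : QH) : Om.tw (d c) = -d (twist c) := by
  ext1 <;> apply Quaternion.ext <;> simp [Om.tw, partialI_apply, partialJ_apply, twist_apply]

/-- The flat Levi-Civita bimodule connection of the calculus: the Grassmann connection of the frame
`di, dj`, that is `∇di = ∇dj = 0` and `∇(a di + b dj) = da ⊗ di + db ⊗ dj`, with its braiding. -/
def levi : BimoduleConnection where
  nabla := AddMonoidHom.mk' (fun w => OmT.tmul (d w.ci) di + OmT.tmul (d w.cj) dj)
    (fun v w => by simp only [map_add, OmT.add_tmul]; abel)
  sigma := braiding
  nabla_smul a w := by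
    have hw : OmT.tmul (d a) w = OmT.tmul (d a) (w.ci • di) + OmT.tmul (d a) (w.cj • dj) := by
      rw [← OmT.tmul_add, ← Om.eq_comb]
    simp only [AddMonoidHom.mk'_apply, hw, map_smul, smul_eq_mul, d_mul, OmT.add_tmul,
      OmT.op_smul_tmul, OmT.smul_tmul, smul_add]
    abel
  sigma_right c t := by
    induction t using OmT.induction with
    | zero => simp
    | tmul w v =>
      simp only [OmT.map_tmul, Om.rmul_apply, braiding_tmul, Om.tw_op, map_neg, map_add, map_smul,
        op_di, op_dj, OmT.op_smul_tmul]
    | add s t h1 h2 => simp only [map_add, h1, h2]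
  nabla_op c w := by
    simp only [AddMonoidHom.mk'_apply, Om.ci_op, Om.cj_op, map_add, OmT.map_tmul, Om.rmul_apply,
      braiding_tmul, d_twist, d_mul, op_di, op_dj, OmT.add_tmul, OmT.op_smul_tmul, OmT.smul_tmul,
      OmT.neg_tmul, smul_neg]
    abel

end Connection

section Induced

/-- The identification `Ω¹ = Ω¹ ⊗_ℍ ℍ`. -/
def insOne : Om →ₗ[QH] OmT QH where
  toFun w := OmT.tmul w 1
  map_add' v w := OmT.add_tmul v w 1
  map_smul' a w := OmT.smul_tmul a w 1

/-- The wedge product `Ω¹ ⊗ Ω¹ → Ω²`. -/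
def wedgeOm : OmT Om →ₗ[QH] Om2 QH := wedge QH ∘ₗ OmT.map insOne

/-- The quantum symmetric two-tensors, the kernel of `∧ : Ω¹ ⊗ Ω¹ → Ω²`. -/
def S2 : Submodule QH (OmT Om) := LinearMap.ker wedgeOm

/-- The quantum metric `g = di ⊗ dj - dj ⊗ di`. -/
def metric : OmT Om := OmT.tmul di dj - OmT.tmul dj di

theorem metric_mem : metric ∈ S2 := by
  have := wedge_rel ![1, qj, -qi] ![qk, qi, qj] (1 : QH) (by
    simp only [Fin.sum_univ_three]
    simp only [Matrix.cons_val_zero, Matrix.cons_val_one, Matrix.cons_val]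
    rw [d_qi, d_qj, d_qk, one_smul, neg_smul]; abel)
  simp only [Fin.sum_univ_three] at this
  simp only [Matrix.cons_val_zero, Matrix.cons_val_one, Matrix.cons_val, d_one, d_qi, d_qj,
    map_neg, OmT.neg_tmul, OmT.zero_tmul, map_zero, zero_add] at this
  change wedge QH (OmT.map insOne (OmT.tmul di dj - OmT.tmul dj di)) = 0
  rw [map_sub, map_sub, ← neg_eq_zero, ← this]
  change -(wedge QH (OmT.tmul di (OmT.tmul dj 1)) - wedge QH (OmT.tmul dj (OmT.tmul di 1))) = _
  abel

theorem add_braiding_tmul (w v : Om) : OmT.tmul w v + braiding (OmT.tmul w v) =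
    (w.ci * twist v.cj - w.cj * twist v.ci) • metric := by
  have hw := Om.eq_comb w
  have e1 : ∀ (u : Om) (c : QH), OmT.tmul di (c • u) = twist c • OmT.tmul di u := fun u c => by
    rw [← OmT.op_smul_tmul, op_di, OmT.smul_tmul]
  have e2 : ∀ (u : Om) (c : QH), OmT.tmul dj (c • u) = twist c • OmT.tmul dj u := fun u c => by
    rw [← OmT.op_smul_tmul, op_dj, OmT.smul_tmul]
  have h1 : OmT.tmul w v = w.ci • OmT.tmul di v + w.cj • OmT.tmul dj v := by
    nth_rewrite 1 [hw]; rw [OmT.add_tmul, OmT.smul_tmul, OmT.smul_tmul]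
  have h2 : Om.tw v = twist v.ci • di + twist v.cj • dj := by
    ext1 <;> simp [Om.tw, di, dj]
  have h3 : ∀ u : Om, OmT.tmul u v = OmT.tmul u (v.ci • di) + OmT.tmul u (v.cj • dj) := fun u => by
    rw [← OmT.tmul_add, ← Om.eq_comb]
  rw [braiding_tmul, h1, h2, h3, h3]
  simp only [e1, e2, OmT.add_tmul, OmT.smul_tmul, metric, smul_sub, sub_smul, smul_add, mul_smul]
  abel

/-- The map `½ (id + σ)` on `Ω¹ ⊗ Ω¹`. -/
def symmetrize (C : BimoduleConnection) (t : OmT Om) : OmT Om := (2 : QH)⁻¹ • (t + C.sigma t)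

theorem symmetrize_mem (t : OmT Om) : symmetrize levi t ∈ S2 := by
  refine S2.smul_mem _ ?_
  change t + braiding t ∈ S2
  induction t using OmT.induction with
  | zero => simp
  | tmul w v => rw [add_braiding_tmul]; exact S2.smul_mem _ metric_mem
  | add s t h1 h2 =>
    have : s + t + braiding (s + t) = (s + braiding s) + (t + braiding t) := by
      rw [map_add]; abel
    rw [this]; exact S2.add_mem h1 h2

/-- The map `s^{1,1} = ½ (id + σ) : Ω¹ ⊗ Ω¹ → S²`. -/
def s11 (t : OmT Om) : S2 := ⟨symmetrize levi t, symmetrize_mem t⟩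

/-- The inclusion `ι¹ : Ω¹ → J¹ℍ`. -/
def iota1 : Om →ₗ[QH] J1 QH := (J1.incl : OmT QH →ₗ[QH] J1 QH) ∘ₗ insOne

theorem spencer1_incl (t : OmT Om) :
    spencer1 (OmT.map ((J1.incl : OmT QH →ₗ[QH] J1 QH) ∘ₗ insOne) t) = wedgeOm t := by
  induction t using OmT.induction with
  | zero => simp
  | tmul w v =>
    simp only [OmT.map_tmul, spencer1_tmul, LinearMap.comp_apply, J1.pt_incl, spencer0,
      AddMonoidHom.neg_apply, J1.form_incl, OmT.tmul_neg, map_neg, sub_neg_eq_add]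
    have : extD w (0 : QH) = 0 := by simp [extD, OmT.tmul_zero]
    rw [this, zero_add]; rfl
  | add s t h1 h2 => simp only [map_add, h1, h2]

theorem J1.map_id (x : J1 (J1 QH)) : J1.map LinearMap.id x = x := by
  ext1
  · rw [J1.form_map]
    induction x.form using OmT.induction with
    | zero => simp
    | tmul w e => rfl
    | add s t h1 h2 => rw [map_add, h1, h2]
  · rfl

theorem map_proj_iota1 (t : OmT Om) :
    OmT.map (J1.proj : J1 QH →ₗ[QH] QH) (OmT.map iota1 t) = 0 := by
  induction t using OmT.induction with
  | zero => simp
  | tmul w e => exact OmT.tmul_zero w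
  | add s t h1 h2 => rw [map_add, map_add, h1, h2, add_zero]

theorem incl_mem_hol (t : OmT Om) (ht : t ∈ S2) :
    (J1.incl (OmT.map iota1 t) : J1 (J1 QH)) ∈ hol QH := by
  refine ⟨?_, ?_⟩
  · ext1
    · rw [J1.form_map, J1.form_incl, map_proj_iota1]; rfl
    · rfl
  · have h : spencer0 (J1.incl (OmT.map iota1 t)) = -OmT.map iota1 t := rfl
    rw [h, map_neg, neg_eq_zero]
    exact (spencer1_incl t).trans ht

/-- The inclusion `ι² : S² → J²ℍ`, the restriction of
`Ω¹ ⊗ Ω¹ → Ω¹ ⊗ J¹ℍ → J¹(J¹ℍ)`. -/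
def iota2 : S2 →ₗ[QH] Jet QH 2 :=
  LinearMap.codRestrict (stage QH 0).next
    ((J1.incl : OmT (J1 QH) →ₗ[QH] J1 (J1 QH)) ∘ₗ OmT.map iota1 ∘ₗ S2.subtype)
    (fun t => (congrArg (· ∈ hol QH) (J1.map_id _)).mpr (incl_mem_hol t.1 t.2))

/-- `φ` is a left linear lift of `Δ` to the jet module, `Δ = φ ∘ jⁿ`. -/
def IsLift (n : ℕ) (Δ : DiffOp n) (φ : Jet QH n →ₗ[QH] QH) : Prop := ∀ h, φ (jet n h) = Δ.1 h

/-- The full quantization induced by the connection `∇` and `s^{1,1}`: `q⁰ = id`,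
`q¹(σ) = r¹(σ) ∘ d`, `q²(σ) = r²(σ) ∘ s^{1,1} ∘ ∇ ∘ d`, and the other components are zero. Here
`rⁿ(σ) : Sⁿ → ℍ` is the left linear map given by the symbol, namely `φ ∘ ιⁿ` for `σ` the symbol of an
operator with lift `φ`. -/
structure IsInduced (Q : FullQuantization) : Prop where
  q_zero : ∀ Δ : DiffOp 0, Q.q 0 (symb 0 Δ) = Δ
  q_one : ∀ (Δ : DiffOp 1) (φ : Jet QH 1 →ₗ[QH] QH), IsLift 1 Δ φ →
    ∀ h, (Q.q 1 (symb 1 Δ)).1 h = φ (iota1 (d h))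
  q_two : ∀ (Δ : DiffOp 2) (φ : Jet QH 2 →ₗ[QH] QH), IsLift 2 Δ φ →
    ∀ h, (Q.q 2 (symb 2 Δ)).1 h = φ (iota2 (s11 (levi.nabla (d h))))
  q_ge_three : ∀ n, 3 ≤ n → Q.q n = 0

end Induced

/-- The units `i` (index `0`) and `j` (index `1`). -/
def unitQ : Fin 2 → QH
  | 0 => qi
  | 1 => qj

/-- The generalized positions `x_a = ς⁰(R_a)`, for `a ∈ {i, j}`. -/
def symbX (a : Fin 2) : SymbAlg := inDeg 0 (symb 0 (rightMulOp (unitQ a)))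

/-- The generalized momenta `p_a = ς¹(∂_a)`, for `a ∈ {i, j}`. -/
def symbP (a : Fin 2) : SymbAlg := inDeg 1 (symb 1 (partialD a))

/-- The unit `1 = ς⁰(id)` of the symbol algebra. -/
def symbOne : SymbAlg := inDeg 0 (symb 0 (rightMulOp 1))

/-- The subalgebra generated by `S` for the product `μ`: the smallest subspace that contains the
unit and `S` and is closed under `μ`. -/
def genSubalg (μ : SymbAlg →ₗ[ℝ] SymbAlg →ₗ[ℝ] SymbAlg) (S : Set SymbAlg) : Submodule ℝ SymbAlg :=
  sInf {N | symbOne ∈ N ∧ S ⊆ N ∧ ∀ a ∈ N, ∀ b ∈ N, μ a b ∈ N}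

end QuatQuant

end

open QuatQuant

noncomputable section

open scoped TensorProduct

namespace QuatQuant

/-! The whole problem lives in the 16-dimensional space End_ℝ(ℍ). Every endomorphism A is uniquely a
sum of three pieces: R_{A(1)}; then R_u ∘ ∂_i + R_v ∘ ∂_j with u = A(i) - iA(1) and v = A(j) -
jA(1); then R_c ∘ ∂_i ∘ ∂_j, where ∂_i∂_j h = h_k and c = A(k) + jA(i) - iA(j) + kA(1) is the
`defect`. The pieces are projections `part n` (`part_sum`, `part_part`).

These projections describe the order filtration. An operator of order zero is a right
multiplication. In J¹ℍ the relation dk = -j di + i dj forces j¹(k) + j j¹(i) - i j¹(j) + k j¹(1) = 0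
(`jet_one_relation`), so the defect of a first-order operator vanishes. Order two is already all of
End_ℝ(ℍ). Hence a symbol of order n amounts to the n-th part of a representative
(`mem_lowerOrder_iff`), and there are no symbols of order three or more.

The induced quantization sends a symbol to this part. In order one this is ι¹(dh) = j¹(h) - h j¹(1).
In order two, ∇dh = h_k g, the braiding fixes g, and ι²(g) is the above combination taken with
2-jets (`jet_two_relation`), on which a lift of A takes the value `defect A`. This gives existence
and uniqueness (`IsInduced.q_symb`).

The star product therefore composes homogeneous operators and splits the result into parts
(`star_partSymb`). Left multiplication by a position and products of momenta give homogeneous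
operators, so ħ does not enter. The twisted Leibniz rule gives ∂_a ∘ R_b = δ_{ab} - R_b ∘ ∂_a for
the units b = i, j, whose order-zero term carries the ħ. -/

/-- The `ℝ`-linear endomorphisms of `ℍ`. -/
abbrev EndH : Type := QH →ₗ[ℝ] QH

/-! ### Splitting endomorphisms of ℍ into parts of order zero, one and two -/

theorem eq_units (h : QH) :
    h = h.re • (1 : QH) + h.imI • qi + h.imJ • qj + h.imK • qk := by
  apply Quaternion.ext <;> simp [qi, qj, qk]

theorem endH_ext {A B : EndH} (h1 : A 1 = B 1) (hi : A qi = B qi) (hj : A qj = B qj)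
    (hk : A qk = B qk) : A = B := by
  refine LinearMap.ext fun h => ?_
  rw [eq_units h]
  simp only [map_add, map_smul, h1, hi, hj, hk]

theorem qi_mul_qj : qi * qj = qk := by apply Quaternion.ext <;> simp [qi, qj, qk]
theorem qj_mul_qi : qj * qi = -qk := by apply Quaternion.ext <;> simp [qi, qj, qk]

theorem twist_qi : twist qi = -qi := by apply Quaternion.ext <;> simp [twist_apply, qi]
theorem twist_qj : twist qj = -qj := by apply Quaternion.ext <;> simp [twist_apply, qj]

@[simp] theorem partialI_one : partialI 1 = 0 := by
  apply Quaternion.ext <;> simp [partialI_apply]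
@[simp] theorem partialI_qi : partialI qi = 1 := by
  apply Quaternion.ext <;> simp [partialI_apply, qi]
@[simp] theorem partialI_qj : partialI qj = 0 := by
  apply Quaternion.ext <;> simp [partialI_apply, qj]
@[simp] theorem partialI_qk : partialI qk = -qj := by
  apply Quaternion.ext <;> simp [partialI_apply, qj, qk]
@[simp] theorem partialJ_one : partialJ 1 = 0 := by
  apply Quaternion.ext <;> simp [partialJ_apply]
@[simp] theorem partialJ_qi : partialJ qi = 0 := by
  apply Quaternion.ext <;> simp [partialJ_apply, qi]
@[simp] theorem partialJ_qj : partialJ qj = 1 := by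
  apply Quaternion.ext <;> simp [partialJ_apply, qj]
@[simp] theorem partialJ_qk : partialJ qk = qi := by
  apply Quaternion.ext <;> simp [partialJ_apply, qi, qk]

@[simp] theorem qi_imK : qi.imK = 0 := rfl
@[simp] theorem qj_imK : qj.imK = 0 := rfl
@[simp] theorem qk_imK : qk.imK = 1 := rfl

/-- The obstruction for an endomorphism of `ℍ` to be a differential operator of order one. -/
def defect : EndH →ₗ[ℝ] QH where
  toFun A := A qk + qj * A qi - qi * A qj + qk * A 1
  map_add' A B := by simp only [LinearMap.add_apply, mul_add]; abel
  map_smul' c A := by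
    simp only [LinearMap.smul_apply, mul_smul_comm, smul_add, smul_sub, RingHom.id_apply]

theorem defect_apply (A : EndH) : defect A = A qk + qj * A qi - qi * A qj + qk * A 1 := rfl

/-- The order zero part of an endomorphism. -/
def partZero : EndH →ₗ[ℝ] EndH :=
  LinearMap.mk₂ ℝ (fun A h => h * A 1) (by simp [mul_add]) (by simp) (by simp [add_mul]) (by simp)

/-- The order one part of an endomorphism. -/
def partOne : EndH →ₗ[ℝ] EndH :=
  LinearMap.mk₂ ℝ
    (fun A h => partialI h * (A qi - qi * A 1) + partialJ h * (A qj - qj * A 1))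
    (by intros; simp only [LinearMap.add_apply, mul_add, mul_sub]; abel)
    (by intros; simp only [LinearMap.smul_apply, mul_smul_comm, ← smul_sub, ← smul_add])
    (by intros; simp only [map_add, add_mul]; abel)
    (by intros; simp only [map_smul, smul_mul_assoc, smul_add])

/-- The order two part of an endomorphism. -/
def partTwo : EndH →ₗ[ℝ] EndH :=
  LinearMap.mk₂ ℝ (fun A h => h.imK • defect A)
    (by simp) (by intros; rw [map_smul, smul_comm]) (by simp [add_smul]) (by simp [mul_smul])

/-- The homogeneous parts of an endomorphism of `ℍ`. -/
def part : ℕ → EndH →ₗ[ℝ] EndH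
  | 0 => partZero
  | 1 => partOne
  | 2 => partTwo
  | _ + 3 => 0

theorem part_zero_apply (A : EndH) (h : QH) : part 0 A h = h * A 1 := rfl
theorem part_one_apply (A : EndH) (h : QH) : part 1 A h =
    partialI h * (A qi - qi * A 1) + partialJ h * (A qj - qj * A 1) := rfl
theorem part_two_apply (A : EndH) (h : QH) : part 2 A h = h.imK • defect A := rfl
theorem part_add_three (n : ℕ) (A : EndH) : part (n + 3) A = 0 := rfl

/-- On 1, i, j the first two parts already reproduce A; `defect A` is by construction the
discrepancy left at k. -/
theorem part_sum (A : EndH) : part 0 A + part 1 A + part 2 A = A := by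
  apply endH_ext <;>
    simp only [LinearMap.add_apply, part_zero_apply, part_one_apply, part_two_apply, partialI_one,
      partialJ_one, partialI_qi, partialJ_qi, partialI_qj, partialJ_qj, partialI_qk, partialJ_qk,
      qi_imK, qj_imK, qk_imK, one_imK, defect_apply, zero_smul, one_smul, zero_mul, one_mul,
      mul_sub, ← mul_assoc, neg_mul, qi_mul_qj, qj_mul_qi] <;> abel

theorem part_zero_eq_iff (A : EndH) : part 0 A = 0 ↔ A 1 = 0 := by
  refine ⟨fun h => ?_, fun h => LinearMap.ext fun x => ?_⟩
  · simpa [part_zero_apply] using LinearMap.congr_fun h 1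
  · simp [part_zero_apply, h]

theorem part_one_eq_zero {A : EndH} (hi : A qi = qi * A 1) (hj : A qj = qj * A 1) :
    part 1 A = 0 :=
  LinearMap.ext fun x => by simp [part_one_apply, hi, hj]

theorem part_two_eq_zero_iff (A : EndH) : part 2 A = 0 ↔ defect A = 0 := by
  refine ⟨fun h => ?_, fun h => LinearMap.ext fun x => ?_⟩
  · simpa [part_two_apply] using LinearMap.congr_fun h qk
  · simp [part_two_apply, h]

theorem defect_part_zero (A : EndH) : defect (part 0 A) = 0 := by
  simp only [defect_apply, part_zero_apply, ← mul_assoc, qi_mul_qj, qj_mul_qi, neg_mul, one_mul]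
  abel

theorem defect_part_one (A : EndH) : defect (part 1 A) = 0 := by
  simp only [defect_apply, part_one_apply]
  simp [mul_sub]
  abel

theorem defect_part_two (A : EndH) : defect (part 2 A) = defect A := by
  simp [defect_apply (part 2 A), part_two_apply]

/-- The parts read off A(1), the pair A(i) - iA(1), A(j) - jA(1), and the defect respectively; each
of these data vanishes on the other two parts. So the parts are complementary projections. -/
theorem part_part (n m : ℕ) (A : EndH) : part n (part m A) = if n = m then part m A else 0 := by
  match n, m with
  | n + 3, m =>
    rw [part_add_three]
    split_ifs with h
    · subst h; rfl
    · rfl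
  | 0, m + 3 | 1, m + 3 | 2, m + 3 =>
    rw [part_add_three, map_zero, if_neg (by omega)]
  | 0, 0 => ext1 h; simp [part_zero_apply]
  | 0, 1 => ext1 h; simp [part_zero_apply, part_one_apply]
  | 0, 2 => ext1 h; simp [part_zero_apply, part_two_apply]
  | 1, 0 =>
    exact part_one_eq_zero (by simp [part_zero_apply]) (by simp [part_zero_apply])
  | 1, 1 => ext1 h; simp [part_one_apply]
  | 1, 2 =>
    exact part_one_eq_zero (by simp [part_two_apply]) (by simp [part_two_apply])
  | 2, 0 => exact (part_two_eq_zero_iff _).2 (defect_part_zero A)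
  | 2, 1 => exact (part_two_eq_zero_iff _).2 (defect_part_one A)
  | 2, 2 => ext1 h; rw [part_two_apply, defect_part_two]; rfl

/-! ### Differential operators of each order -/

theorem rightMulOp_comp_mem (c : QH) {n : ℕ} {A : EndH} (hA : A ∈ DiffOp n) :
    (rightMulOp c).1 ∘ₗ A ∈ DiffOp n := by
  simpa using DiffOp.comp_mem (rightMulOp c).2 hA

/-- Each part is a right multiplication composed with at most n of the operators ∂_i, ∂_j, and
orders add under composition. -/
theorem part_mem (n : ℕ) (A : EndH) : part n A ∈ DiffOp n := by
  match n with
  | 0 => exact (rightMulOp (A 1)).2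
  | 1 =>
    exact add_mem (rightMulOp_comp_mem (A qi - qi * A 1) (partialD 0).2)
      (rightMulOp_comp_mem (A qj - qj * A 1) (partialD 1).2)
  | 2 =>
    have : part 2 A = (rightMulOp (defect A)).1 ∘ₗ ((partialD 0).1 ∘ₗ (partialD 1).1) := by
      ext1 h
      rw [part_two_apply, LinearMap.comp_apply, rightMulOp_apply]
      have : ((partialD 0).1 ∘ₗ (partialD 1).1) h = h.imK • (1 : QH) := by
        change partialI (partialJ h) = _
        apply Quaternion.ext <;> simp [partialI_apply, partialJ_apply]
      rw [this, smul_one_mul]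
    rw [this]
    exact rightMulOp_comp_mem _ (DiffOp.comp_mem (partialD 0).2 (partialD 1).2)
  | n + 3 => exact zero_mem _

/-- Since J⁰ℍ = ℍ, a lift is a left linear endomorphism of ℍ, determined by its value at 1. -/
theorem eq_part_zero {A : EndH} (hA : A ∈ DiffOp 0) : part 0 A = A := by
  obtain ⟨φ, hφ⟩ := hA
  ext1 h
  rw [part_zero_apply, ← hφ, ← hφ, ← smul_eq_mul, ← map_smul]
  exact congrArg φ (mul_one h)

/-- This is the rule j¹(ae) = a j¹(e) + ι¹(da ⊗ e) at e = 1. -/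
theorem iota1_d (h : QH) : iota1 (d h) = J1.prolong h - h • J1.prolong 1 := by
  ext1
  · simp [iota1, insOne]
  · simp [iota1]

/-- The combination of prolongations on which `defect` of an operator is the value of a lift. -/
theorem jet_one_relation : J1.prolong qk + qj • J1.prolong qi - qi • J1.prolong qj +
    qk • J1.prolong 1 = (0 : J1 QH) := by
  ext1
  · simp only [map_add, map_sub, J1.form_smul, J1.form_prolong, J1.pt_prolong, smul_zero, d_qi,
      d_qj, d_qk, map_zero]
    -- Moving i across dj, or j across di, costs a sign; with that sign dj ⊗ i and di ⊗ j cancel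
    -- against dk ⊗ 1.
    have e1 := OmT.op_smul_tmul qi dj (1 : QH)
    have e2 := OmT.op_smul_tmul qj di (1 : QH)
    rw [op_dj, smul_eq_mul, mul_one] at e1
    rw [op_di, smul_eq_mul, mul_one] at e2
    rw [← e1, ← e2]
    simp only [twist_qi, twist_qj, neg_smul, OmT.add_tmul, OmT.neg_tmul]
    abel
  · simp only [map_add, map_sub, J1.pt_smul, J1.pt_prolong, smul_eq_mul, qi_mul_qj, qj_mul_qi,
      mul_one, map_zero]
    abel

/-- Used twice: in J¹ the combination is zero, which kills the defect of first-order operators; in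
J² it is the image of the metric, which identifies the second-order quantization. -/
theorem lift_relation {n : ℕ} {A : EndH} {φ : Jet QH n →ₗ[QH] QH}
    (hφ : ∀ h, φ (jet n h) = A h) :
    φ (jet n qk + qj • jet n qi - qi • jet n qj + qk • jet n 1) = defect A := by
  simp only [map_add, map_sub, map_smul, hφ, smul_eq_mul, defect_apply]

theorem defect_eq_zero {A : EndH} (hA : A ∈ DiffOp 1) : defect A = 0 := by
  obtain ⟨φ, hφ⟩ := hA
  rw [← lift_relation hφ]
  exact (congrArg φ jet_one_relation).trans (map_zero φ)

/-- The three parts of any endomorphism have order at most two; consequently the filtration is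
stationary from here on. -/
theorem diffOp_two : DiffOp 2 = ⊤ := by
  refine eq_top_iff.2 fun A _ => ?_
  rw [← part_sum A]
  exact add_mem (add_mem (DiffOp.mono (by omega) (part_mem 0 A))
    (DiffOp.mono (by omega) (part_mem 1 A))) (part_mem 2 A)

theorem diffOp_eq_top {n : ℕ} (hn : 2 ≤ n) : DiffOp n = ⊤ :=
  top_unique (diffOp_two ▸ DiffOp.mono hn)

/-- The parts of order larger than `n` of an operator of order `n` vanish. -/
theorem part_eq_zero_of_mem {n m : ℕ} (h : n < m) {A : EndH} (hA : A ∈ DiffOp n) :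
    part m A = 0 := by
  match m, n with
  | m + 3, _ => rfl
  | 2, 1 => exact (part_two_eq_zero_iff A).2 (defect_eq_zero hA)
  | 2, 0 => exact (part_two_eq_zero_iff A).2 (defect_eq_zero (DiffOp.le_succ 0 hA))
  | 1, 0 => rw [← eq_part_zero hA, part_part]; rfl

theorem sub_part_mem_lowerOrder {n : ℕ} {A : EndH} (hA : A ∈ DiffOp n) :
    A - part n A ∈ lowerOrder n := by
  match n with
  | 0 => rw [eq_part_zero hA, sub_self]; exact zero_mem _
  | 1 =>
    have : A - part 1 A = part 0 A := by
      nth_rewrite 1 [← part_sum A]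
      rw [part_eq_zero_of_mem one_lt_two hA]; abel
    rw [this]; exact part_mem 0 A
  | 2 =>
    have : A - part 2 A = part 0 A + part 1 A := by
      nth_rewrite 1 [← part_sum A]; abel
    rw [this]; exact add_mem (DiffOp.le_succ 0 (part_mem 0 A)) (part_mem 1 A)
  | n + 3 =>
    change _ ∈ DiffOp (n + 2)
    rw [diffOp_eq_top (by omega)]; trivial

/-- Identifies the quotient by lower order with the image of `part n`: a symbol is the homogeneous
part of any of its representatives. -/
theorem mem_lowerOrder_iff {n : ℕ} {A : EndH} (hA : A ∈ DiffOp n) :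
    A ∈ lowerOrder n ↔ part n A = 0 := by
  refine ⟨fun h => ?_, fun h => by simpa [h] using sub_part_mem_lowerOrder hA⟩
  cases n with
  | zero => rw [(Submodule.mem_bot ℝ).1 h, map_zero]
  | succ n => exact part_eq_zero_of_mem n.lt_succ_self h

/-- The homogeneous part of order `n` as an operator. -/
def partOp (n : ℕ) : EndH →ₗ[ℝ] DiffOp n := LinearMap.codRestrict _ (part n) (part_mem n)

@[simp] theorem partOp_val (n : ℕ) (A : EndH) : (partOp n A).1 = part n A := rfl

theorem symb_eq_zero_iff {n : ℕ} (A : DiffOp n) : symb n A = 0 ↔ part n A.1 = 0 :=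
  (Submodule.Quotient.mk_eq_zero (symbKer n)).trans (mem_lowerOrder_iff A.2)

theorem symb_partOp {n : ℕ} (A : DiffOp n) : symb n (partOp n A.1) = symb n A := by
  rw [← sub_eq_zero, ← map_sub, symb_eq_zero_iff]
  change part n (part n A.1 - A.1) = 0
  rw [map_sub, part_part, if_pos rfl, sub_self]

theorem symb_surjective (n : ℕ) : Function.Surjective (symb n) := Submodule.mkQ_surjective _

/-! ### The induced quantization -/

/-- The coefficients of the parts are built from values of A by left multiplications only, and ψ
commutes with these. Applied to ψ = R_c it also shows that left multiplication by positions needs no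
correction. -/
theorem part_postComp (ψ : QH →ₗ[QH] QH) (n : ℕ) (A : EndH) :
    part n (ψ.restrictScalars ℝ ∘ₗ A) = ψ.restrictScalars ℝ ∘ₗ part n A := by
  have hs : ∀ a h : QH, ψ (a * h) = a * ψ h := fun a h => ψ.map_smul a h
  have hr : ∀ (a : ℝ) (h : QH), ψ (a • h) = a • ψ h := (ψ.restrictScalars ℝ).map_smul
  match n with
  | 0 => ext1 h; simp [part_zero_apply, hs]
  | 1 => ext1 h; simp [part_one_apply, hs]
  | 2 => ext1 h; simp [part_two_apply, defect_apply, hs, hr]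
  | n + 3 => simp [part_add_three]

/-- The quantization that sends a symbol to its homogeneous representative. -/
def partQuantization : FullQuantization where
  q n := Submodule.liftQ (symbKer n) (partOp n ∘ₗ (DiffOp n).subtype) (fun A hA =>
    Subtype.ext ((mem_lowerOrder_iff A.2).1 hA))
  symb_q n σ := by
    obtain ⟨A, rfl⟩ := symb_surjective n σ
    exact symb_partOp A
  q_postComp ψ n A := Subtype.ext (part_postComp ψ n A.1)

/-! ### The second-order term and the metric -/

/-- Only the coefficients of j in ∂_i h and of i in ∂_j h are seen by d; they are -h_k and h_k,
which produces the antisymmetric combination. -/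
theorem nabla_d (h : QH) : levi.nabla (d h) = (h.imK : QH) • metric := by
  change OmT.tmul (d (partialI h)) di + OmT.tmul (d (partialJ h)) dj = _
  have h1 : d (partialI h) = -((h.imK : QH) • dj) := by
    ext1 <;> apply Quaternion.ext <;> simp [partialI_apply, partialJ_apply, dj]
  have h2 : d (partialJ h) = (h.imK : QH) • di := by
    ext1 <;> apply Quaternion.ext <;> simp [partialI_apply, partialJ_apply, di]
  rw [h1, h2, OmT.neg_tmul, OmT.smul_tmul, OmT.smul_tmul, metric, smul_sub]
  abel

theorem braiding_metric : braiding metric = metric := by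
  rw [metric, map_sub, braiding_tmul, braiding_tmul, tw_di, tw_dj]
  simp [di, dj]
  abel

theorem s11_nabla_d (h : QH) : (s11 (levi.nabla (d h))).1 = (h.imK : QH) • metric := by
  change (2 : QH)⁻¹ • (_ + braiding _) = _
  have h2 : (2 : QH) ≠ 0 := fun h0 => two_ne_zero (α := ℝ) (congrArg QuaternionAlgebra.re h0)
  rw [nabla_d, map_smul, braiding_metric, ← two_smul QH, smul_smul, inv_mul_cancel₀ h2,
    one_smul]

/-- The combination that vanishes for 1-jets survives for 2-jets. Its base point is zero by
`jet_one_relation`, and its form component, after the sign rule for moving i, j across the frame, is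
di ⊗ ι¹(dj) - dj ⊗ ι¹(di). -/
theorem jet_two_relation : (J1.incl (OmT.map iota1 metric) : J1 (J1 QH)) =
    J1.prolong (J1.prolong qk) + qj • J1.prolong (J1.prolong qi) -
      qi • J1.prolong (J1.prolong qj) + qk • J1.prolong (J1.prolong 1) := by
  ext1
  · have e1 := OmT.op_smul_tmul qi dj (J1.prolong (1 : QH))
    have e2 := OmT.op_smul_tmul qj di (J1.prolong (1 : QH))
    rw [op_dj, twist_qi] at e1
    rw [op_di, twist_qj] at e2
    -- Writing di and dj as differentials of i and j lets `iota1_d` expand ι¹ in prolongations.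
    simp only [map_add, map_sub, J1.form_smul, J1.form_prolong, J1.pt_prolong, smul_zero, d_qk,
      J1.form_incl, metric, OmT.map_tmul, ← d_qi, ← d_qj, iota1_d, OmT.tmul_sub]
    rw [d_qi, d_qj, ← e1, ← e2]
    simp only [neg_smul, OmT.add_tmul, OmT.neg_tmul]
    abel
  · simpa only [map_add, map_sub, J1.pt_incl, J1.pt_smul, J1.pt_prolong] using
      jet_one_relation.symm

theorem iota2_s11_nabla_d (h : QH) : iota2 (s11 (levi.nabla (d h))) =
    (h.imK : QH) • (jet 2 qk + qj • jet 2 qi - qi • jet 2 qj + qk • jet 2 1) := by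
  apply Subtype.ext
  change (J1.incl (OmT.map iota1 (s11 (levi.nabla (d h))).1) : J1 (J1 QH)) = _
  rw [s11_nabla_d, map_smul, map_smul, jet_two_relation]
  rfl

/-- By `iota1_d` the left side is A(h) - hA(1), which removes the order-zero part; the second-order
part is absent because A has order one. -/
theorem lift_one_eq {A : DiffOp 1} {φ : Jet QH 1 →ₗ[QH] QH} (hφ : IsLift 1 A φ) (h : QH) :
    φ (iota1 (d h)) = part 1 A.1 h := by
  have h1 : φ (iota1 (d h)) = A.1 h - part 0 A.1 h := by
    rw [part_zero_apply, ← hφ h, ← hφ 1, iota1_d]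
    exact (map_sub φ _ _).trans (congrArg _ (map_smul φ _ _))
  have h2 := LinearMap.congr_fun (part_sum A.1) h
  rw [part_eq_zero_of_mem one_lt_two A.2, add_zero, LinearMap.add_apply] at h2
  rw [h1, ← h2]; abel

theorem lift_two_eq {A : DiffOp 2} {φ : Jet QH 2 →ₗ[QH] QH} (hφ : IsLift 2 A φ) (h : QH) :
    φ (iota2 (s11 (levi.nabla (d h)))) = part 2 A.1 h := by
  rw [iota2_s11_nabla_d, map_smul, lift_relation hφ, part_two_apply, smul_eq_mul,
    Quaternion.coe_mul_eq_smul]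

theorem partQuantization_isInduced : IsInduced partQuantization where
  q_zero A := Subtype.ext (eq_part_zero A.2)
  q_one _ _ hφ h := (lift_one_eq hφ h).symm
  q_two _ _ hφ h := (lift_two_eq hφ h).symm
  q_ge_three n hn := by
    obtain ⟨n, rfl⟩ := Nat.exists_eq_add_of_le' hn
    refine LinearMap.ext fun σ => ?_
    obtain ⟨A, rfl⟩ := symb_surjective _ σ
    rfl

/-- Every operator has a lift, so the defining conditions leave no freedom. All later results use an
induced quantization through this formula alone. -/
theorem IsInduced.q_symb {Q : FullQuantization} (hQ : IsInduced Q) (n : ℕ) (A : DiffOp n) :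
    Q.q n (symb n A) = partOp n A.1 := by
  obtain ⟨φ, hφ⟩ := A.2
  match n with
  | 0 => exact (hQ.q_zero A).trans (Subtype.ext (eq_part_zero A.2).symm)
  | 1 =>
    exact Subtype.ext (LinearMap.ext fun h => (hQ.q_one A φ hφ h).trans (lift_one_eq hφ h))
  | 2 =>
    exact Subtype.ext (LinearMap.ext fun h => (hQ.q_two A φ hφ h).trans (lift_two_eq hφ h))
  | n + 3 => rw [hQ.q_ge_three _ (by omega)]; rfl

theorem existsUnique_isInduced : ∃! Q : FullQuantization, IsInduced Q := by
  refine ⟨partQuantization, partQuantization_isInduced, fun Q hQ => ?_⟩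
  have : Q.q = partQuantization.q := by
    funext n
    refine LinearMap.ext fun σ => ?_
    obtain ⟨A, rfl⟩ := symb_surjective _ σ
    exact hQ.q_symb n A
  cases Q
  subst this
  rfl

/-! ### The star product -/

/-- The symbol of order `n` of the homogeneous part of order `n`, in the symbol algebra. -/
def partSymb (n : ℕ) : EndH →ₗ[ℝ] SymbAlg := inDeg n ∘ₗ symb n ∘ₗ partOp n

theorem partSymb_apply (n : ℕ) (A : EndH) : partSymb n A = inDeg n (symb n (partOp n A)) := rfl

/-- Symbols can thus be indexed by arbitrary endomorphisms, without order hypotheses and without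
transport between the types `Symb n`. -/
theorem inDeg_symb {n : ℕ} (A : DiffOp n) : inDeg n (symb n A) = partSymb n A.1 := by
  rw [partSymb_apply, symb_partOp]

theorem inDeg_injective (n : ℕ) : Function.Injective (inDeg n) := DirectSum.of_injective n

theorem partSymb_part (n : ℕ) (A : EndH) : partSymb n (part n A) = partSymb n A := by
  rw [partSymb_apply, partSymb_apply]
  congr 2
  exact Subtype.ext ((part_part n n A).trans (if_pos rfl))

theorem partSymb_eq_zero {n : ℕ} {A : EndH} (h : part n A = 0) : partSymb n A = 0 := by
  have : partOp n A = 0 := Subtype.ext h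
  rw [partSymb_apply, this, map_zero, map_zero]

/-- In order zero nothing is divided out, so c is recovered by evaluating the operator at 1. -/
theorem partSymb_zero_injective : Function.Injective fun c : QH => partSymb 0 (rightMulOp c).1 := by
  intro a b h
  have h1 := inDeg_injective 0 h
  have h2 : symb 0 (partOp 0 (rightMulOp a).1 - partOp 0 (rightMulOp b).1) = 0 := by
    rw [map_sub, sub_eq_zero]; exact h1
  rw [symb_eq_zero_iff] at h2
  have h3 := (part_zero_eq_iff _).1 h2
  have h4 : (1 : QH) * (1 * a) - 1 * (1 * b) = 0 := h3
  simpa [sub_eq_zero] using h4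

/-- The symbol algebra is spanned by the symbols of homogeneous parts. -/
theorem symbAlg_induction {p : SymbAlg → Prop} (zero : p 0)
    (symb : ∀ n A, p (partSymb n A)) (add : ∀ u v, p u → p v → p (u + v)) (u : SymbAlg) : p u := by
  induction u using DirectSum.induction_on with
  | zero => exact zero
  | of n σ =>
    obtain ⟨A, rfl⟩ := symb_surjective n σ
    exact inDeg_symb A ▸ symb n A.1
  | add u v hu hv => exact add u v hu hv

theorem symbMul_partSymb (n m : ℕ) (A B : EndH) :
    symbMul (partSymb n A) (partSymb m B) = partSymb (n + m) (part n A ∘ₗ part m B) := by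
  rw [partSymb_apply, partSymb_apply, symbMul, bilinExt_inDeg]
  exact inDeg_symb (comp n m (partOp n A) (partOp m B))

section Induced

variable {Q : FullQuantization} (hQ : IsInduced Q)
include hQ

/-- The subtracted operator is the part of order n + 1, on which the lower projections vanish. -/
theorem part_truncStep (n : ℕ) (A : DiffOp (n + 1)) {l : ℕ} (hl : l ≤ n) :
    part l (Q.truncStep n A).1 = part l A.1 := by
  change part l (A.1 - (Q.q (n + 1) (symb (n + 1) A)).1) = _
  rw [hQ.q_symb, partOp_val, map_sub, part_part, if_neg (by omega), sub_zero]

theorem part_truncAux (k r : ℕ) (A : DiffOp (k + r)) :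
    part k (Q.truncAux k r A).1 = part k A.1 := by
  induction r with
  | zero => rfl
  | succ r ih =>
    exact (ih (Q.truncStep (k + r) A)).trans (part_truncStep hQ (k + r) A (Nat.le_add_right k r))

theorem inDeg_symbComp (N k : ℕ) (A : DiffOp N) :
    inDeg k (Q.symbComp N k A) = partSymb k A.1 := by
  change inDeg k (symb k (Q.trunc N k A)) = _
  rw [inDeg_symb]
  have : partOp k (Q.trunc N k A).1 = partOp k A.1 := Subtype.ext (part_truncAux hQ k N _)
  rw [partSymb_apply, partSymb_apply, this]

/-- The recursive truncation only reads off parts (`inDeg_symbComp`), so every star product becomes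
a computation in End_ℝ(ℍ). -/
theorem star_partSymb (ħ : ℝ) (n m : ℕ) (A B : EndH) :
    Q.star ħ (partSymb n A) (partSymb m B) = ∑ k ∈ Finset.range (n + m + 1),
      ħ ^ k • partSymb (n + m - k) (part n A ∘ₗ part m B) := by
  rw [partSymb_apply n, partSymb_apply m, FullQuantization.star, bilinExt_inDeg, Q.starHom_apply]
  refine Finset.sum_congr rfl fun k _ => ?_
  rw [inDeg_symbComp hQ, hQ.q_symb, hQ.q_symb]
  have h (l : ℕ) (C : EndH) : partOp l (partOp l C).1 = partOp l C :=
    Subtype.ext ((part_part l l C).trans (if_pos rfl))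
  rw [h, h]
  rfl

/-- Orthogonality of the parts kills every term with k ≥ 1, and ħ disappears. -/
theorem star_partSymb_of_homogeneous (ħ : ℝ) {n m : ℕ} {A B : EndH}
    (h : part (n + m) (part n A ∘ₗ part m B) = part n A ∘ₗ part m B) :
    Q.star ħ (partSymb n A) (partSymb m B) = partSymb (n + m) (part n A ∘ₗ part m B) := by
  rw [star_partSymb hQ, Finset.sum_range_succ', Finset.sum_eq_zero, zero_add, pow_zero, one_smul,
    Nat.sub_zero]
  intro k hk
  rw [partSymb_eq_zero, smul_zero]
  rw [← h, part_part, if_neg]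
  rw [Finset.mem_range] at hk
  omega

theorem star_zero (u v : SymbAlg) : Q.star 0 u v = symbMul u v := by
  induction u using symbAlg_induction with
  | zero => simp
  | add u u' h h' => simp only [map_add, LinearMap.add_apply, h, h']
  | symb n A =>
    induction v using symbAlg_induction with
    | zero => simp
    | add v v' h h' => simp only [map_add, h, h']
    | symb m B =>
      -- Only k = 0 survives, with the convention 0 ^ 0 = 1.
      rw [star_partSymb hQ, symbMul_partSymb, Finset.sum_range_succ', Finset.sum_eq_zero]
      · simp
      · intro k _; simp

end Induced

/-! ### The generators -/

/-- The operator `h ↦ h_k`, the composite `∂_i ∂_j`. -/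
def coordK : EndH := partialI ∘ₗ partialJ

theorem coordK_apply (h : QH) : coordK h = h.imK • (1 : QH) := by
  apply Quaternion.ext <;> simp [coordK, partialI_apply, partialJ_apply]

/-- The symbol of a right multiplication. -/
def posSymb : QH →ₗ[ℝ] SymbAlg :=
  partSymb 0 ∘ₗ LinearMap.mk₂ ℝ (fun a h => h * a) (by simp [mul_add]) (by simp)
    (by simp [add_mul]) (by simp)

theorem posSymb_apply (a : QH) : posSymb a = partSymb 0 (rightMulOp a).1 := rfl

theorem symbX_eq (a : Fin 2) : symbX a = posSymb (unitQ a) := inDeg_symb _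
theorem symbOne_eq : symbOne = posSymb 1 := inDeg_symb _
theorem symbP_eq (a : Fin 2) : symbP a = partSymb 1 (partialD a).1 := inDeg_symb _

theorem part_rightMulOp (a : QH) : part 0 (rightMulOp a).1 = (rightMulOp a).1 :=
  eq_part_zero (rightMulOp a).2

theorem part_one_eq_self {A : EndH} (h1 : A 1 = 0) (hA : defect A = 0) : part 1 A = A := by
  have h := part_sum A
  rwa [(part_zero_eq_iff A).2 h1, (part_two_eq_zero_iff A).2 hA, zero_add, add_zero] at h

theorem part_two_eq_self {A : EndH} (h1 : A 1 = 0) (hi : A qi = 0) (hj : A qj = 0) :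
    part 2 A = A := by
  have h := part_sum A
  rwa [(part_zero_eq_iff A).2 h1, part_one_eq_zero (by simp [h1, hi]) (by simp [h1, hj]),
    zero_add, zero_add] at h

theorem partialD_one (a : Fin 2) : (partialD a).1 1 = 0 := by
  fin_cases a
  · exact partialI_one
  · exact partialJ_one

theorem part_partialD (a : Fin 2) : part 1 (partialD a).1 = (partialD a).1 :=
  part_one_eq_self (partialD_one a) (defect_eq_zero (partialD a).2)

theorem partialD_unitQ (a b : Fin 2) : (partialD a).1 (unitQ b) = if a = b then 1 else 0 := by
  fin_cases a <;> fin_cases b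
  · exact partialI_qi
  · exact partialI_qj
  · exact partialJ_qi
  · exact partialJ_qj

theorem partialD_mul (a : Fin 2) (h c : QH) :
    (partialD a).1 (h * c) = h * (partialD a).1 c + (partialD a).1 h * twist c := by
  fin_cases a
  · exact partialI_mul h c
  · exact partialJ_mul h c

theorem twist_unitQ (a : Fin 2) : twist (unitQ a) = -unitQ a := by
  fin_cases a
  · exact twist_qi
  · exact twist_qj

theorem part_coordK : part 2 coordK = coordK :=
  part_two_eq_self (by simp [coordK_apply]) (by simp [coordK_apply]) (by simp [coordK_apply])

/-- First derivatives of i and j are constants, so the composite annihilates 1, i, j and only its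
second-order part can be nonzero. -/
theorem part_two_partialD_comp (a b : Fin 2) :
    part 2 ((partialD a).1 ∘ₗ (partialD b).1) = (partialD a).1 ∘ₗ (partialD b).1 := by
  have h : ∀ c : Fin 2, (partialD a).1 (if b = c then 1 else 0) = 0 := fun c => by
    split_ifs
    · exact partialD_one a
    · exact map_zero _
  refine part_two_eq_self ?_ ?_ ?_
  · rw [LinearMap.comp_apply, partialD_one, map_zero]
  · rw [LinearMap.comp_apply, show qi = unitQ 0 from rfl, partialD_unitQ, h]
  · rw [LinearMap.comp_apply, show qj = unitQ 1 from rfl, partialD_unitQ, h]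

theorem partialD_comp_zero_one : (partialD 0).1 ∘ₗ (partialD 1).1 = coordK := rfl

theorem partialD_comp_one_zero : (partialD 1).1 ∘ₗ (partialD 0).1 = -coordK := by
  ext1 h
  rw [LinearMap.neg_apply, coordK_apply]
  change partialJ (partialI h) = _
  apply Quaternion.ext <;> simp [partialI_apply, partialJ_apply]

theorem partialD_comp_self (a : Fin 2) : (partialD a).1 ∘ₗ (partialD a).1 = 0 := by
  ext1 h
  fin_cases a
  · change partialI (partialI h) = 0
    apply Quaternion.ext <;> simp [partialI_apply]
  · change partialJ (partialJ h) = 0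
    apply Quaternion.ext <;> simp [partialJ_apply]

/-- Third-order products of momenta vanish: `coordK` has values in ℝ·1, which ∂_a kills, while in
the other order ∂_a h has no k-component. -/
theorem partialD_coordK (a : Fin 2) : (partialD a).1 ∘ₗ coordK = 0 := by
  ext1 h
  rw [LinearMap.comp_apply, coordK_apply, map_smul, partialD_one, smul_zero]; rfl

theorem coordK_partialD (a : Fin 2) : coordK ∘ₗ (partialD a).1 = 0 := by
  ext1 h
  rw [LinearMap.comp_apply, coordK_apply]
  fin_cases a
  · change (partialI h).imK • (1 : QH) = 0
    simp [partialI_apply]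
  · change (partialJ h).imK • (1 : QH) = 0
    simp [partialJ_apply]

theorem coordK_coordK : coordK ∘ₗ coordK = 0 := by
  ext1 h
  rw [LinearMap.comp_apply, coordK_apply, coordK_apply]
  simp

theorem rightMulOp_one_comp (A : EndH) : (rightMulOp 1).1 ∘ₗ A = A := by
  ext1 h; rw [LinearMap.comp_apply, rightMulOp_apply, mul_one]

theorem comp_rightMulOp_one (A : EndH) : A ∘ₗ (rightMulOp 1).1 = A := by
  ext1 h; rw [LinearMap.comp_apply, rightMulOp_apply, mul_one]

theorem part_rightMulOp_comp (c : QH) (n : ℕ) (A : EndH) :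
    part n ((rightMulOp c).1 ∘ₗ A) = (rightMulOp c).1 ∘ₗ part n A :=
  part_postComp (LinearMap.toSpanSingleton QH QH c) n A

/-! ### Star products of positions and momenta -/

section Generators

variable {Q : FullQuantization} (hQ : IsInduced Q) (ħ : ℝ)
include hQ

/-- Multiplication by a position on the left receives no corrections. -/
theorem posSymb_star (c : QH) (n : ℕ) (A : EndH) :
    Q.star ħ (posSymb c) (partSymb n A) = partSymb n ((rightMulOp c).1 ∘ₗ A) := by
  have h0 : part 0 (rightMulOp c).1 ∘ₗ part n A = part n ((rightMulOp c).1 ∘ₗ A) := by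
    rw [part_rightMulOp, part_rightMulOp_comp]
  rw [posSymb_apply, star_partSymb_of_homogeneous hQ, h0, show 0 + n = n from zero_add n,
    partSymb_part]
  rw [h0, part_part, if_pos (zero_add n)]

/-- Right multiplications compose in reverse order, which is why the opposite algebra appears. -/
theorem posSymb_star_posSymb (a b : QH) :
    Q.star ħ (posSymb a) (posSymb b) = posSymb (b * a) := by
  rw [posSymb_apply b, posSymb_star hQ, posSymb_apply]
  congr 1
  ext1 h
  exact mul_assoc h b a

theorem one_star (u : SymbAlg) : Q.star ħ symbOne u = u := by
  induction u using symbAlg_induction with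
  | zero => simp
  | add u v hu hv => rw [map_add, hu, hv]
  | symb n A => rw [symbOne_eq, posSymb_star hQ, rightMulOp_one_comp]

theorem partSymb_star_one (n : ℕ) (A : EndH) :
    Q.star ħ (partSymb n A) symbOne = partSymb n A := by
  have h0 : part n A ∘ₗ part 0 (rightMulOp 1).1 = part n A := by
    rw [part_rightMulOp, comp_rightMulOp_one]
  rw [symbOne_eq, posSymb_apply, star_partSymb_of_homogeneous hQ, h0, add_zero,
    partSymb_part]
  rw [h0, part_part, if_pos (add_zero n)]

theorem symbP_star_symbP (a b : Fin 2) :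
    Q.star ħ (symbP a) (symbP b) = partSymb 2 ((partialD a).1 ∘ₗ (partialD b).1) := by
  rw [symbP_eq, symbP_eq, star_partSymb_of_homogeneous hQ, part_partialD, part_partialD]
  rw [part_partialD, part_partialD]
  exact part_two_partialD_comp a b

/-- Since conjugation by k negates i and j, the twisted Leibniz rule splits ∂_a ∘ R_b into -R_b ∘
∂_a, homogeneous of order one, and the constant δ_{ab}, one order below the top and hence weighted
by ħ. -/
theorem symbP_star_symbX (a b : Fin 2) : Q.star ħ (symbP a) (symbX b) =
    -symbMul (symbX b) (symbP a) + ħ • (if a = b then symbOne else 0) := by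
  have hc : (partialD a).1 ∘ₗ (rightMulOp (unitQ b)).1 =
      (rightMulOp (if a = b then 1 else 0)).1 - (rightMulOp (unitQ b)).1 ∘ₗ (partialD a).1 := by
    ext1 h
    change (partialD a).1 (h * unitQ b) = h * _ - (partialD a).1 h * unitQ b
    rw [partialD_mul, partialD_unitQ, twist_unitQ, mul_neg, sub_eq_add_neg]
  have h1 : part 1 (rightMulOp (if a = b then 1 else 0)).1 = 0 :=
    part_eq_zero_of_mem one_pos (rightMulOp _).2
  have h0 : part 0 ((rightMulOp (unitQ b)).1 ∘ₗ (partialD a).1) = 0 := by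
    rw [part_rightMulOp_comp, (part_zero_eq_iff _).2 (partialD_one a), LinearMap.comp_zero]
  have h2 : partSymb 0 (rightMulOp (if a = b then 1 else 0)).1 = if a = b then symbOne else 0 := by
    rw [← posSymb_apply]
    split_ifs
    · exact symbOne_eq.symm
    · exact map_zero _
  rw [symbP_eq, symbX_eq, posSymb_apply, star_partSymb hQ, symbMul_partSymb, part_partialD,
    part_rightMulOp, hc, Finset.sum_range_succ, Finset.sum_range_one]
  simp only [map_sub, pow_zero, one_smul, pow_one]
  -- The two summands sit in degrees 1 and 0; each receives only one of the two terms of `hc`.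
  rw [show partSymb (1 + 0 - 0) = partSymb 1 from rfl,
    show partSymb (1 + 0 - 1) = partSymb 0 from rfl, show partSymb (0 + 1) = partSymb 1 from rfl,
    partSymb_eq_zero h1, partSymb_eq_zero h0, zero_sub, sub_zero, h2]

end Generators

/-! ### Generated subalgebras -/

section Generation

variable {μ : SymbAlg →ₗ[ℝ] SymbAlg →ₗ[ℝ] SymbAlg} {S : Set SymbAlg}

theorem one_mem_genSubalg : symbOne ∈ genSubalg μ S :=
  Submodule.mem_sInf.2 fun _ h => h.1

theorem subset_genSubalg : S ⊆ genSubalg μ S := fun _ hs =>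
  Submodule.mem_sInf.2 fun _ h => h.2.1 hs

theorem mul_mem_genSubalg {u v : SymbAlg} (hu : u ∈ genSubalg μ S) (hv : v ∈ genSubalg μ S) :
    μ u v ∈ genSubalg μ S :=
  Submodule.mem_sInf.2 fun N h =>
    h.2.2 u (Submodule.mem_sInf.1 hu N h) v (Submodule.mem_sInf.1 hv N h)

theorem genSubalg_le {N : Submodule ℝ SymbAlg} (h1 : symbOne ∈ N) (hS : S ⊆ N)
    (hmul : ∀ u ∈ N, ∀ v ∈ N, μ u v ∈ N) : genSubalg μ S ≤ N :=
  sInf_le ⟨h1, hS, hmul⟩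

/-- A spanning family of a generated subalgebra. -/
theorem genSubalg_eq_span {T : Set SymbAlg} (h1 : symbOne ∈ T) (hS : S ⊆ T)
    (hT : T ⊆ genSubalg μ S) (hmul : ∀ u ∈ T, ∀ v ∈ T, μ u v ∈ Submodule.span ℝ T) :
    genSubalg μ S = Submodule.span ℝ T := by
  refine le_antisymm (genSubalg_le (Submodule.subset_span h1)
    (hS.trans Submodule.subset_span) fun u hu v hv => ?_) (Submodule.span_le.2 hT)
  -- By bilinearity, closure under the product need only be checked on the spanning set.
  have : Submodule.map₂ μ (Submodule.span ℝ T) (Submodule.span ℝ T) ≤ Submodule.span ℝ T := by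
    rw [Submodule.map₂_span_span, Submodule.span_le]
    rintro _ ⟨u, hu, v, hv, rfl⟩
    exact hmul u hu v hv
  exact this (Submodule.apply_mem_map₂ μ hu hv)

theorem eqOn_span {ν : SymbAlg →ₗ[ℝ] SymbAlg →ₗ[ℝ] SymbAlg} {T : Set SymbAlg}
    (h : ∀ u ∈ T, ∀ v ∈ T, μ u v = ν u v) {u v : SymbAlg} (hu : u ∈ Submodule.span ℝ T)
    (hv : v ∈ Submodule.span ℝ T) : μ u v = ν u v := by
  refine LinearMap.eqOn_span (f := μ.flip v) (g := ν.flip v) (fun x hx => ?_) hu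
  exact LinearMap.eqOn_span (f := μ x) (g := ν x) (fun y hy => h x hx y hy) hv

end Generation

/-! ### The subalgebras generated by positions, by momenta, and by both -/

section Subalgebras

variable {Q : FullQuantization} (hQ : IsInduced Q) (ħ : ℝ)
include hQ

theorem posSymb_mem {N : Submodule ℝ SymbAlg} (h1 : symbOne ∈ N) (hX : Set.range symbX ⊆ N)
    (hmul : ∀ u ∈ N, ∀ v ∈ N, Q.star ħ u v ∈ N) (c : QH) : posSymb c ∈ N := by
  have hi : posSymb qi ∈ N := symbX_eq 0 ▸ hX ⟨0, rfl⟩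
  have hj : posSymb qj ∈ N := symbX_eq 1 ▸ hX ⟨1, rfl⟩
  have hk : posSymb qk ∈ N := by
    -- The missing unit is k = ij, obtained as the star product of the symbols of j and i in that
    -- order.
    rw [← qi_mul_qj, ← posSymb_star_posSymb hQ ħ]
    exact hmul _ hj _ hi
  rw [symbOne_eq] at h1
  rw [eq_units c]
  simp only [map_add, map_smul]
  exact N.add_mem (N.add_mem (N.add_mem (N.smul_mem _ h1) (N.smul_mem _ hi)) (N.smul_mem _ hj))
    (N.smul_mem _ hk)

theorem genSubalg_symbX :
    genSubalg (Q.star ħ) (Set.range symbX) = LinearMap.range posSymb := by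
  refine le_antisymm (genSubalg_le ⟨1, symbOne_eq.symm⟩ ?_ ?_) ?_
  · rintro _ ⟨a, rfl⟩
    exact ⟨unitQ a, (symbX_eq a).symm⟩
  · rintro _ ⟨a, rfl⟩ _ ⟨b, rfl⟩
    exact ⟨b * a, (posSymb_star_posSymb hQ ħ a b).symm⟩
  · rintro _ ⟨c, rfl⟩
    exact posSymb_mem hQ ħ one_mem_genSubalg subset_genSubalg
      (fun _ hu _ hv => mul_mem_genSubalg hu hv) c

theorem exists_opEquiv : ∃ f : QHᵐᵒᵖ ≃ₗ[ℝ] genSubalg (Q.star ħ) (Set.range symbX),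
    (f 1 : SymbAlg) = symbOne ∧
      ∀ u v : QHᵐᵒᵖ, (f (u * v) : SymbAlg) = Q.star ħ (f u) (f v) := by
  have hinj : Function.Injective posSymb := partSymb_zero_injective
  refine ⟨(MulOpposite.opLinearEquiv ℝ).symm ≪≫ₗ LinearEquiv.ofInjective posSymb hinj ≪≫ₗ
    LinearEquiv.ofEq _ _ (genSubalg_symbX hQ ħ).symm, symbOne_eq.symm, fun u v => ?_⟩
  exact (posSymb_star_posSymb hQ ħ u.unop v.unop).symm

/-- The products of the momenta, which span the subalgebra that they generate. -/
def momenta : Set SymbAlg := {symbOne, symbP 0, symbP 1, partSymb 2 coordK}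

omit hQ in
theorem mem_momenta_iff (u : SymbAlg) : u ∈ momenta ↔
    u = symbOne ∨ (∃ a, u = symbP a) ∨ u = partSymb 2 coordK := by
  simp [momenta, Fin.exists_fin_two, or_assoc]

theorem symbP_star_coordK (a : Fin 2) :
    Q.star ħ (symbP a) (partSymb 2 coordK) = 0 := by
  have h : part 1 (partialD a).1 ∘ₗ part 2 coordK = 0 := by
    rw [part_partialD, part_coordK, partialD_coordK]
  rw [symbP_eq, star_partSymb hQ, h]
  simp

theorem coordK_star_symbP (a : Fin 2) :
    Q.star ħ (partSymb 2 coordK) (symbP a) = 0 := by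
  have h : part 2 coordK ∘ₗ part 1 (partialD a).1 = 0 := by
    rw [part_partialD, part_coordK, coordK_partialD]
  rw [symbP_eq, star_partSymb hQ, h]
  simp

theorem coordK_star_coordK :
    Q.star ħ (partSymb 2 coordK) (partSymb 2 coordK) = 0 := by
  have h : part 2 coordK ∘ₗ part 2 coordK = 0 := by rw [part_coordK, coordK_coordK]
  rw [star_partSymb hQ, h]
  simp

theorem symbP_star_symbP_mem (a b : Fin 2) :
    Q.star ħ (symbP a) (symbP b) ∈ Submodule.span ℝ momenta := by
  have hK : partSymb 2 coordK ∈ Submodule.span ℝ momenta :=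
    Submodule.subset_span (by simp [momenta])
  rw [symbP_star_symbP hQ]
  fin_cases a <;> fin_cases b <;> simp only [Fin.zero_eta, Fin.mk_one]
  · rw [partialD_comp_self, map_zero]; exact zero_mem _
  · exact hK
  · rw [partialD_comp_one_zero, map_neg]; exact neg_mem hK
  · rw [partialD_comp_self, map_zero]; exact zero_mem _

theorem momenta_star_mem {u v : SymbAlg} (hu : u ∈ momenta) (hv : v ∈ momenta) :
    Q.star ħ u v ∈ Submodule.span ℝ momenta := by
  have hu' := hu
  have hv' := hv
  rw [mem_momenta_iff] at hu hv
  rcases hu with rfl | ⟨a, rfl⟩ | rfl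
  · rw [one_star hQ]; exact Submodule.subset_span hv'
  all_goals rcases hv with rfl | ⟨b, rfl⟩ | rfl
  · rw [symbP_eq, partSymb_star_one hQ, ← symbP_eq]; exact Submodule.subset_span hu'
  · exact symbP_star_symbP_mem hQ ħ a b
  · rw [symbP_star_coordK hQ]; exact zero_mem _
  · rw [partSymb_star_one hQ]; exact Submodule.subset_span hu'
  · rw [coordK_star_symbP hQ]; exact zero_mem _
  · rw [coordK_star_coordK hQ]; exact zero_mem _

/-- Each product either involves the unit, is a homogeneous composite ∂_a ∘ ∂_b, or is zero, so no
power of ħ can enter. -/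
theorem momenta_star_eq (ħ' : ℝ) {u v : SymbAlg} (hu : u ∈ momenta) (hv : v ∈ momenta) :
    Q.star ħ u v = Q.star ħ' u v := by
  rw [mem_momenta_iff] at hu hv
  rcases hu with rfl | ⟨a, rfl⟩ | rfl
  · rw [one_star hQ, one_star hQ]
  all_goals rcases hv with rfl | ⟨b, rfl⟩ | rfl
  · rw [symbP_eq, partSymb_star_one hQ, partSymb_star_one hQ]
  · rw [symbP_star_symbP hQ, symbP_star_symbP hQ]
  · rw [symbP_star_coordK hQ, symbP_star_coordK hQ]
  · rw [partSymb_star_one hQ, partSymb_star_one hQ]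
  · rw [coordK_star_symbP hQ, coordK_star_symbP hQ]
  · rw [coordK_star_coordK hQ, coordK_star_coordK hQ]

theorem genSubalg_symbP :
    genSubalg (Q.star ħ) (Set.range symbP) = Submodule.span ℝ momenta := by
  refine genSubalg_eq_span (by simp [momenta]) ?_ ?_ fun u hu v hv => momenta_star_mem hQ ħ hu hv
  · rintro _ ⟨a, rfl⟩
    exact (mem_momenta_iff _).2 (Or.inr (Or.inl ⟨a, rfl⟩))
  · intro u hu
    rw [mem_momenta_iff] at hu
    rcases hu with rfl | ⟨a, rfl⟩ | rfl
    · exact one_mem_genSubalg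
    · exact subset_genSubalg ⟨a, rfl⟩
    · rw [← partialD_comp_zero_one, ← symbP_star_symbP hQ ħ]
      exact mul_mem_genSubalg (subset_genSubalg ⟨0, rfl⟩) (subset_genSubalg ⟨1, rfl⟩)

/-- Positions multiplied from the left supply arbitrary right coefficients without corrections, so
1, p_i, p_j and p_i ⋆ p_j generate every part; orders three and above contribute nothing. -/
theorem genSubalg_eq_top :
    genSubalg (Q.star ħ) (Set.range symbX ∪ Set.range symbP) = ⊤ := by
  set N := genSubalg (Q.star ħ) (Set.range symbX ∪ Set.range symbP)
  have hmul : ∀ u ∈ N, ∀ v ∈ N, Q.star ħ u v ∈ N := fun _ hu _ hv => mul_mem_genSubalg hu hv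
  have hX : ∀ c, posSymb c ∈ N := posSymb_mem hQ ħ one_mem_genSubalg
    (Set.subset_union_left.trans subset_genSubalg) hmul
  have hP : ∀ a, symbP a ∈ N := fun a => subset_genSubalg (Or.inr ⟨a, rfl⟩)
  refine eq_top_iff.2 fun u _ => ?_
  induction u using symbAlg_induction with
  | zero => exact zero_mem _
  | add u v hu hv => exact add_mem (hu trivial) (hv trivial)
  | symb n A =>
    match n with
    | 0 => rw [← partSymb_part]; exact hX (A 1)
    | 1 =>
      have : part 1 A = (rightMulOp (A qi - qi * A 1)).1 ∘ₗ (partialD 0).1 +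
        (rightMulOp (A qj - qj * A 1)).1 ∘ₗ (partialD 1).1 := rfl
      rw [← partSymb_part, this, map_add, ← posSymb_star hQ ħ, ← posSymb_star hQ ħ, ← symbP_eq, ← symbP_eq]
      exact add_mem (hmul _ (hX _) _ (hP 0)) (hmul _ (hX _) _ (hP 1))
    | 2 =>
      have : part 2 A = (rightMulOp (defect A)).1 ∘ₗ ((partialD 0).1 ∘ₗ (partialD 1).1) := by
        ext1 h
        rw [part_two_apply, LinearMap.comp_apply, rightMulOp_apply, partialD_comp_zero_one,
          coordK_apply, smul_one_mul]
      rw [← partSymb_part, this, ← posSymb_star hQ ħ, ← symbP_star_symbP hQ ħ]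
      exact hmul _ (hX _) _ (hmul _ (hP 0) _ (hP 1))
    | n + 3 => rw [partSymb_eq_zero rfl]; exact zero_mem _

end Subalgebras

end QuatQuant

end

theorem proposition5p53 :
    (∃! Q : FullQuantization, IsInduced Q) ∧
    ∀ Q : FullQuantization, IsInduced Q →
      (∀ ħ : ℝ,
        -- the relations between the generators
        (∀ a b : Fin 2, Q.star ħ (symbX a) (symbX b) = symbMul (symbX a) (symbX b)) ∧
        (∀ a b : Fin 2, Q.star ħ (symbP a) (symbX b) =
          -symbMul (symbX b) (symbP a) + ħ • (if a = b then symbOne else 0)) ∧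
        (∀ a b : Fin 2, Q.star ħ (symbX a) (symbP b) = symbMul (symbX a) (symbP b)) ∧
        (∀ a b : Fin 2, Q.star ħ (symbP a) (symbP b) = symbMul (symbP a) (symbP b)) ∧
        -- the `x_a` and `p_a` generate the whole algebra
        genSubalg (Q.star ħ) (Set.range symbX ∪ Set.range symbP) = ⊤ ∧
        -- the `x_a` generate a subalgebra isomorphic to the opposite quaternions
        (∃ f : QHᵐᵒᵖ ≃ₗ[ℝ] genSubalg (Q.star ħ) (Set.range symbX),
          (f 1 : SymbAlg) = symbOne ∧
          ∀ u v : QHᵐᵒᵖ, (f (u * v) : SymbAlg) = Q.star ħ (f u) (f v)) ∧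
        Q.star ħ (symbP 0) (symbP 1) = -Q.star ħ (symbP 1) (symbP 0) ∧
        (∀ a : Fin 2, Q.star ħ (symbP a) (symbP a) = 0)) ∧
      -- independence of `ħ` of the subalgebras generated by the `x_a` and by the `p_a`
      (∀ ħ ħ' : ℝ,
        (genSubalg (Q.star ħ) (Set.range symbX) = genSubalg (Q.star ħ') (Set.range symbX) ∧
          ∀ u ∈ genSubalg (Q.star ħ) (Set.range symbX),
          ∀ v ∈ genSubalg (Q.star ħ) (Set.range symbX), Q.star ħ u v = Q.star ħ' u v) ∧
        (genSubalg (Q.star ħ) (Set.range symbP) = genSubalg (Q.star ħ') (Set.range symbP) ∧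
          ∀ u ∈ genSubalg (Q.star ħ) (Set.range symbP),
          ∀ v ∈ genSubalg (Q.star ħ) (Set.range symbP), Q.star ħ u v = Q.star ħ' u v)) ∧
      -- the classical limit
      (∀ u v : SymbAlg, Q.star 0 u v = symbMul u v) := by
  refine ⟨existsUnique_isInduced, fun Q hQ => ⟨fun ħ => ⟨fun a b => ?_, fun a b => ?_, fun a b => ?_,
    fun a b => ?_, ?_, ?_, ?_, fun a => ?_⟩, fun ħ ħ' => ⟨⟨?_, ?_⟩, ?_, ?_⟩, star_zero hQ⟩⟩
  -- The symbol product is read as the star product at ħ = 0, so the claim becomes independence of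
  -- ħ.
  · rw [← star_zero hQ, symbX_eq, symbX_eq, posSymb_star_posSymb hQ, posSymb_star_posSymb hQ]
  · exact symbP_star_symbX hQ ħ a b
  · rw [← star_zero hQ, symbX_eq, symbP_eq, posSymb_star hQ, posSymb_star hQ]
  · rw [← star_zero hQ, symbP_star_symbP hQ, symbP_star_symbP hQ]
  · exact genSubalg_eq_top hQ ħ
  · exact exists_opEquiv hQ ħ
  · rw [symbP_star_symbP hQ, symbP_star_symbP hQ, partialD_comp_one_zero, map_neg, neg_neg]
    rfl
  · rw [symbP_star_symbP hQ, partialD_comp_self, map_zero]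
  · rw [genSubalg_symbX hQ, genSubalg_symbX hQ]
  · rw [genSubalg_symbX hQ]
    rintro _ ⟨a, rfl⟩ _ ⟨b, rfl⟩
    rw [posSymb_star_posSymb hQ, posSymb_star_posSymb hQ]
  · rw [genSubalg_symbP hQ, genSubalg_symbP hQ]
  · rw [genSubalg_symbP hQ]
    intro u hu v hv
    exact eqOn_span (fun x hx y hy => momenta_star_eq hQ ħ ħ' hx hy) hu hv
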